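/- Let $k$ be a commutative ring. For words in positive integers let $uv$ denote concatenation and let $\sqcup\!\sqcup$ denote the shuffle product on linear combinations of words, determined by $\emptyset\sqcup\!\sqcup v=v=v\sqcup\!\sqcup\emptyset$ and $xu\sqcup\!\sqcup yv=x(u\sqcup\!\sqcup yv)+y(xu\sqcup\!\sqcup v)$ for letters $x,y$; concatenation binds tighter than $\sqcup\!\sqcup$. The Malvenuto–Reutenauer Hopf algebra is the free $k$-module on all permutations of all sets $[m]=\{1,\dots,m\}$, $m\ge 0$, in one-line notation, with product $\pi\cdot\tau=\pi\sqcup\!\sqcup(\tau+m)$ for $\pi\in\mathfrak S_m$ (where $\tau+m$ is $\tau$ with $m$ added to each letter), coproduct $\Delta(\pi)=\sum_{i=0}^m \mathrm{st}(\pi_1\cdots\pi_i)\otimes\mathrm{st}(\pi_{i+1}\cdots\pi_m)$, where $\mathrm{st}$ is standardization, unit $\emptyset$, and counit the coefficient of $\emptyset$. Let $S$ be its antipode. For a permutation $\sigma$ let $S(\sigma)_j^*$ be the part of $S(\sigma)$ (viewed as a combination of words) made of the words ending in $j$, with that last letter removed. Let $\eta_{i,l}$ be the word $i(i+1)\cdots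 l$ if $i\le l$, the empty word if $i=l+1$, and $0$ if $i\ge l+2$. Let $\delta_{l,i}$ be the word $l(l-1)\cdots i$ if $i\le l$, the empty word if $i=l+1$, and $0$ if $i\ge l+2$. Empty sums are $0$. **Theorem.** Let $1\le b<a\le n$ be integers, $A=\{a,b\}$, and $\sigma_A=ab\,\eta_{1,b-1}\eta_{b+1,a-1}\eta_{a+1,n}\in\mathfrak S_n$. For $j\ge 3$ put $P_j=\big(1\sqcup\!\sqcup (j-1)\eta_{2,j-2}-\delta_{j-1,j-2}\eta_{1,j-3}\big)\sqcup\!\sqcup\delta_{n,j+1}$. 1. If $b=1$, then $S(\sigma_A)_1^*=(-1)^{n+1}(2\sqcup\!\sqcup\delta_{n,4})3$. 2. If $b=2$, then $S(\sigma_A)_1^*=(-1)^{n}(32\sqcup\!\sqcup\delta_{n,5})4$. 3. If $b\ge3$, then $S(\sigma_A)_1^*=(-1)^{n+b+1}\big[(b+1)\eta_{2,b-1}\sqcup\!\sqcup\delta_{n,b+2}\big]b+\sum_{i=4}^{b}(-1)^{n+i}\big(i\,\eta_{2,i-1}\sqcup\!\sqcup\delta_{n,i+1}\big)$. 4. If $b=1$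 and $a=2$, then $S(\sigma_A)_2^*=(-1)^n(1\sqcup\!\sqcup\delta_{n,3})$. 5. If $b=1$ and $a\ge3$, then $S(\sigma_A)_2^*=(-1)^n(1\sqcup\!\sqcup\delta_{n,3}+31\sqcup\!\sqcup\delta_{n,4})$. 6. If $b=2$, then $S(\sigma_A)_2^*=(-1)^{n+1}\big[1\sqcup\!\sqcup(3\sqcup\!\sqcup\delta_{n,5})4\big]$. 7. If $b\ge3$, then $S(\sigma_A)_2^*=(-1)^{n+1}\big[1\sqcup\!\sqcup(3\sqcup\!\sqcup\delta_{n,5})4+431\sqcup\!\sqcup\delta_{n,5}\big]$. 8. If $3\le j\le b-1$, then $S(\sigma_A)_j^*=(-1)^{n+j+1}\big[P_j+1\sqcup\!\sqcup(j+1)\eta_{2,j-1}\sqcup\!\sqcup\delta_{n,j+2}+\delta_{j+2,j+1}\eta_{1,j-1}\sqcup\!\sqcup\delta_{n,j+3}\big]$. 9. If $3\le j=b$, then $S(\sigma_A)_j^*=(-1)^{n+j+1}\big[P_j+1\sqcup\!\sqcup(j+1)\eta_{2,j-1}\sqcup\!\sqcup\delta_{n,j+2}\big]$. 10. If $3\le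 j=b+1$ and $a=b+1$, then $S(\sigma_A)_j^*=(-1)^{n+j+1}P_j$. 11. If $3\le j=b+1$ and $a\ge b+2$, then $S(\sigma_A)_j^*=(-1)^{n+j+1}\big[P_j-(j+1)(j-1)\eta_{1,j-2}\sqcup\!\sqcup\delta_{n,j+2}\big]$. 12. If $b+2\le j\le n$ and $j\le a-1$, then $S(\sigma_A)_j^*=(-1)^{n+j}\big[(j-1)b\,\eta_{1,b-1}\eta_{b+1,j-2}\sqcup\!\sqcup\delta_{n,j+1}+(j+1)b\,\eta_{1,b-1}\eta_{b+1,j-1}\sqcup\!\sqcup\delta_{n,j+2}\big]$. 13. If $b+2\le j\le n$ and $j=a$, then $S(\sigma_A)_j^*=(-1)^{n+j}\big[(j-1)b\,\eta_{1,b-1}\eta_{b+1,j-2}\sqcup\!\sqcup\delta_{n,j+1}\big]$. 14. If $b+2\le j\le n$ and $j\ge a+1$, then $S(\sigma_A)_j^*=0$. In particular, for $1\le j\le b$ the element $S(\sigma_A)_j^*$ does not depend on $a$: it is the same for $A=\{a,b\}$ and $A=\{a',b\}$ whenever $b<a,a'\le n$. (Here $(j-1)$, $(j+1)$, $(b+1)$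 in front of a word denote single letters.) -/

import Mathlib

noncomputable section

open scoped TensorProduct

namespace MalvenutoReutenauer

/-! ### Words, concatenation and shuffles -/

/-- The free associative algebra `k⟨ℕ⟩` as a module: formal `k`-linear combinations of words.
Its product is `concat` below (the pointwise product of finitely supported functions is never
used). -/
abbrev Words (k : Type*) [CommRing k] := List ℕ →₀ k

section WordAlgebra

variable {k : Type*} [CommRing k]

/-- A word as an element of `k⟨ℕ⟩`. -/
def word (u : List ℕ) : Words k := Finsupp.single u 1

/-- Bilinear extension of a function of two words. -/
def bilin {M : Type*} [AddCommGroup M] [Module k M] (f : List ℕ → List ℕ → M) :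
    Words k →ₗ[k] Words k →ₗ[k] M :=
  Finsupp.linearCombination k (fun u => Finsupp.linearCombination k (f u))

/-- Concatenation, the product of `k⟨ℕ⟩`. -/
def concat : Words k →ₗ[k] Words k →ₗ[k] Words k := bilin (fun u v => word (u ++ v))

/-- The shuffle product of two words:
`∅ ⧢ v = v`, `u ⧢ ∅ = u`, `a u ⧢ b v = a (u ⧢ b v) + b (a u ⧢ v)`. -/
def shuffleWord : List ℕ → List ℕ → Words k
  | [], v => word v
  | a :: u, [] => word (a :: u)
  | a :: u, b :: v =>
      concat (word [a]) (shuffleWord u (b :: v)) + concat (word [b]) (shuffleWord (a :: u) v)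
termination_by u v => u.length + v.length

/-- The shuffle product on `k⟨ℕ⟩`. -/
def shuffle : Words k →ₗ[k] Words k →ₗ[k] Words k := bilin shuffleWord

/-- Linear extension of the letterwise application of `f` to words. -/
def mapLetters (f : ℕ → ℕ) : Words k →ₗ[k] Words k :=
  Finsupp.linearCombination k (fun u => word (u.map f))

@[simp] theorem bilin_word {M : Type*} [AddCommGroup M] [Module k M]
    (f : List ℕ → List ℕ → M) (u v : List ℕ) : bilin (k := k) f (word u) (word v) = f u v := by
  simp [bilin, word]

@[simp] theorem concat_word (u v : List ℕ) :
    concat (word u : Words k) (word v) = word (u ++ v) := by simp [concat]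

@[simp] theorem shuffle_word (u v : List ℕ) :
    shuffle (word u : Words k) (word v) = shuffleWord u v := by simp [shuffle]

@[simp] theorem lc_word {M : Type*} [AddCommGroup M] [Module k M] (f : List ℕ → M)
    (u : List ℕ) : Finsupp.linearCombination k f (word u) = f u := by
  simp [word]

@[simp] theorem mapLetters_word (f : ℕ → ℕ) (u : List ℕ) :
    mapLetters f (word u : Words k) = word (u.map f) := by simp [mapLetters]

theorem words_ext {M : Type*} [AddCommGroup M] [Module k M] {f g : Words k →ₗ[k] M}
    (h : ∀ u, f (word u) = g (word u)) : f = g := by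
  ext u; exact h u

@[simp] theorem shuffleWord_nil_left (v : List ℕ) :
    shuffleWord [] v = (word v : Words k) := by simp [shuffleWord]

@[simp] theorem shuffleWord_nil_right (u : List ℕ) :
    shuffleWord u [] = (word u : Words k) := by cases u <;> simp [shuffleWord]

theorem shuffleWord_cons_cons (a b : ℕ) (u v : List ℕ) :
    (shuffleWord (a :: u) (b :: v) : Words k) =
      concat (word [a]) (shuffleWord u (b :: v)) + concat (word [b]) (shuffleWord (a :: u) v) := by
  rw [shuffleWord]

theorem shuffle_nil_left (x : Words k) : shuffle (word []) x = x := by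
  have : shuffle (word [] : Words k) = LinearMap.id := words_ext (by simp)
  rw [this]; rfl

theorem shuffle_nil_right (x : Words k) : shuffle x (word []) = x := by
  have : (shuffle (k := k)).flip (word []) = LinearMap.id := words_ext (by simp)
  exact congrArg (fun f => f x) this

theorem shuffle_concat_concat (a b : ℕ) (x y : Words k) :
    shuffle (concat (word [a]) x) (concat (word [b]) y) =
      concat (word [a]) (shuffle x (concat (word [b]) y)) +
        concat (word [b]) (shuffle (concat (word [a]) x) y) := by
  induction x using Finsupp.induction_linear with
  | zero => simp
  | add x x' hx hx' => simp only [map_add, LinearMap.add_apply, hx, hx']; abel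
  | single u r =>
    induction y using Finsupp.induction_linear with
    | zero => simp
    | add y y' hy hy' => simp only [map_add, hy, hy']; abel
    | single v s =>
      have h1 : (Finsupp.single u r : Words k) = r • word u := by simp [word]
      have h2 : (Finsupp.single v s : Words k) = s • word v := by simp [word]
      rw [h1, h2]
      simp [shuffleWord_cons_cons]

theorem shuffle_assoc_word (u v w : List ℕ) :
    shuffle (shuffleWord u v : Words k) (word w) = shuffle (word u) (shuffleWord v w) := by
  match u, v, w with
  | [], v, w => simp [shuffle_nil_left]
  | a :: u, [], w => simp
  | a :: u, b :: v, [] => simp [shuffle_nil_right]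
  | a :: u, b :: v, c :: w =>
    have e (d : ℕ) (t : List ℕ) : (word (d :: t) : Words k) = concat (word [d]) (word t) := by simp
    have i1 := shuffle_assoc_word u (b :: v) (c :: w)
    have i2 := shuffle_assoc_word (a :: u) v (c :: w)
    have i3 := shuffle_assoc_word (a :: u) (b :: v) w
    rw [shuffleWord_cons_cons a b, shuffleWord_cons_cons b c, map_add, LinearMap.add_apply,
      map_add, e c w, e a u, shuffle_concat_concat, shuffle_concat_concat, shuffle_concat_concat,
      shuffle_concat_concat, ← e, ← e, i1, i2]
    rw [shuffleWord_cons_cons a b, shuffleWord_cons_cons b c] at *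
    simp only [map_add, LinearMap.add_apply] at *
    rw [← i3]
    simp only [map_add]
    abel
termination_by u.length + v.length + w.length

theorem shuffle_assoc (x y z : Words k) :
    shuffle (shuffle x y) z = shuffle x (shuffle y z) := by
  induction x using Finsupp.induction_linear with
  | zero => simp
  | add x x' hx hx' => simp only [map_add, LinearMap.add_apply, hx, hx']
  | single u r =>
  induction y using Finsupp.induction_linear with
  | zero => simp
  | add y y' hy hy' => simp only [map_add, LinearMap.add_apply, hy, hy']
  | single v s =>
  induction z using Finsupp.induction_linear with
  | zero => simp
  | add z z' hz hz' => simp only [map_add, hz, hz']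
  | single w t =>
    have h (u : List ℕ) (r : k) : (Finsupp.single u r : Words k) = r • word u := by simp [word]
    rw [h u, h v, h w]
    simp [shuffle_assoc_word]

theorem mapLetters_concat (f : ℕ → ℕ) (a : ℕ) (x : Words k) :
    mapLetters f (concat (word [a]) x) = concat (word [f a]) (mapLetters f x) := by
  have : mapLetters f ∘ₗ concat (word [a] : Words k) =
      concat (word [f a]) ∘ₗ mapLetters f := words_ext (by simp)
  exact congrArg (fun g => g x) this

theorem mapLetters_shuffleWord (f : ℕ → ℕ) (u v : List ℕ) :
    mapLetters f (shuffleWord u v : Words k) = shuffleWord (u.map f) (v.map f) := by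
  match u, v with
  | [], v => simp
  | a :: u, [] => simp
  | a :: u, b :: v =>
    simp only [shuffleWord_cons_cons, List.map_cons, map_add, mapLetters_concat]
    rw [mapLetters_shuffleWord f u (b :: v), mapLetters_shuffleWord f (a :: u) v]
    simp
termination_by u.length + v.length

/-- Linear maps that agree on all rearrangements of `u ++ v` agree on `u ⧢ v`. -/
theorem eq_on_shuffleWord {M : Type*} [AddCommMonoid M] [Module k M] (u v : List ℕ)
    {F G : Words k →ₗ[k] M} (h : ∀ w : List ℕ, w.Perm (u ++ v) → F (word w) = G (word w)) :
    F (shuffleWord u v) = G (shuffleWord u v) := by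
  match u, v with
  | [], v => simpa using h v (by simp)
  | a :: u, [] => simpa using h (a :: u) (by simp)
  | a :: u, b :: v =>
    rw [shuffleWord_cons_cons, map_add, map_add]
    congr 1
    · refine eq_on_shuffleWord (F := F ∘ₗ concat (word [a])) (G := G ∘ₗ concat (word [a]))
        u (b :: v) (fun w hw => ?_)
      simpa using h (a :: w) (by simpa using hw)
    · refine eq_on_shuffleWord (F := F ∘ₗ concat (word [b])) (G := G ∘ₗ concat (word [b]))
        (a :: u) v (fun w hw => ?_)
      have : (b :: w).Perm (a :: u ++ b :: v) :=
        (hw.cons b).trans (List.perm_middle (l₁ := a :: u)).symm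
      simpa using h (b :: w) this
termination_by u.length + v.length

/-! ### Deconcatenation -/

/-- The sum of `g p s` over all factorizations `w = p s`. -/
def splitSum {M : Type*} [AddCommMonoid M] (w : List ℕ) (g : List ℕ → List ℕ → M) : M :=
  ∑ i ∈ Finset.range (w.length + 1), g (w.take i) (w.drop i)

theorem splitSum_nil {M : Type*} [AddCommMonoid M] (g : List ℕ → List ℕ → M) :
    splitSum [] g = g [] [] := by simp [splitSum]

theorem splitSum_cons {M : Type*} [AddCommMonoid M] (a : ℕ) (w : List ℕ)
    (g : List ℕ → List ℕ → M) :
    splitSum (a :: w) g = g [] (a :: w) + splitSum w (fun p s => g (a :: p) s) := by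
  simp only [splitSum, List.length_cons]
  rw [Finset.sum_range_succ']
  simp [add_comm]

theorem splitSum_add {M : Type*} [AddCommMonoid M] (w : List ℕ) (g h : List ℕ → List ℕ → M) :
    splitSum w (fun p s => g p s + h p s) = splitSum w g + splitSum w h := by
  simp [splitSum, Finset.sum_add_distrib]

theorem splitSum_assoc {M : Type*} [AddCommMonoid M] (w : List ℕ)
    (f : List ℕ → List ℕ → List ℕ → M) :
    splitSum w (fun p s => splitSum p (fun p₁ p₂ => f p₁ p₂ s)) =
      splitSum w (fun p s => splitSum s (fun s₁ s₂ => f p s₁ s₂)) := by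
  induction w generalizing f with
  | nil => simp [splitSum_nil]
  | cons a w ih => simp only [splitSum_cons, splitSum_nil, splitSum_add, ih, add_assoc]

theorem splitSum_congr {M : Type*} [AddCommMonoid M] {w : List ℕ} {g h : List ℕ → List ℕ → M}
    (H : ∀ p s, p ++ s = w → g p s = h p s) : splitSum w g = splitSum w h :=
  Finset.sum_congr rfl (fun i _ => H _ _ (List.take_append_drop i w))

theorem map_splitSum {M N F : Type*} [AddCommMonoid M] [AddCommMonoid N] [FunLike F M N]
    [AddMonoidHomClass F M N] (φ : F) (w : List ℕ) (g : List ℕ → List ℕ → M) :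
    φ (splitSum w g) = splitSum w (fun p s => φ (g p s)) := by
  simp [splitSum, map_sum]

theorem splitSum_map {M : Type*} [AddCommMonoid M] (f : ℕ → ℕ) (w : List ℕ)
    (g : List ℕ → List ℕ → M) :
    splitSum (w.map f) g = splitSum w (fun p s => g (p.map f) (s.map f)) := by
  simp [splitSum, List.map_take, List.map_drop]

theorem deconcat_concat {M : Type*} [AddCommGroup M] [Module k M] (g : List ℕ → List ℕ → M)
    (a : ℕ) (x : Words k) :
    Finsupp.linearCombination k (fun w => splitSum w g) (concat (word [a]) x) =
      Finsupp.linearCombination k (g []) (concat (word [a]) x) +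
      Finsupp.linearCombination k (fun w => splitSum w (fun p s => g (a :: p) s)) x := by
  have : Finsupp.linearCombination k (fun w => splitSum w g) ∘ₗ concat (word [a] : Words k) =
      Finsupp.linearCombination k (g []) ∘ₗ concat (word [a]) +
      Finsupp.linearCombination k (fun w => splitSum w (fun p s => g (a :: p) s)) :=
    words_ext (by simp [splitSum_cons])
  exact congrArg (fun f => f x) this

theorem bilin_nil_left {M : Type*} [AddCommGroup M] [Module k M] (g : List ℕ → List ℕ → M)
    (y : Words k) :
    bilin g (word []) y = Finsupp.linearCombination k (g []) y := by
  simp [bilin]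

theorem bilin_concat_left {M : Type*} [AddCommGroup M] [Module k M] (g : List ℕ → List ℕ → M)
    (a : ℕ) (x : Words k) :
    bilin g (concat (word [a]) x) = bilin (fun p s => g (a :: p) s) x := by
  have : bilin g ∘ₗ concat (word [a] : Words k) = bilin (fun p s => g (a :: p) s) :=
    words_ext (by simp [bilin])
  exact congrArg (fun f => f x) this

theorem bilin_cons_left {M : Type*} [AddCommGroup M] [Module k M] (g : List ℕ → List ℕ → M)
    (a : ℕ) (u : List ℕ) (y : Words k) :
    bilin g (word (a :: u)) y = bilin (fun p s => g (a :: p) s) (word u) y := by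
  simp [bilin]

/-- Deconcatenation is multiplicative for the shuffle product. -/
theorem deconcat_shuffleWord {M : Type*} [AddCommGroup M] [Module k M] (u v : List ℕ)
    (g : List ℕ → List ℕ → M) :
    Finsupp.linearCombination k (fun w => splitSum w g) (shuffleWord u v) =
      splitSum u (fun p s => splitSum v (fun q t =>
        bilin (k := k) g (shuffleWord p q) (shuffleWord s t))) := by
  match u, v with
  | [], v => simp [splitSum_nil]
  | a :: u, [] => simp [splitSum_nil]
  | a :: u, b :: v =>
    have i1 := deconcat_shuffleWord u (b :: v) (fun p s => g (a :: p) s)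
    have i2 := deconcat_shuffleWord (a :: u) v (fun p s => g (b :: p) s)
    rw [shuffleWord_cons_cons, map_add, deconcat_concat, deconcat_concat, i1, i2]
    simp only [splitSum_cons, shuffleWord_nil_left, shuffleWord_nil_right, bilin_nil_left,
      shuffleWord_cons_cons, map_add, splitSum_add, LinearMap.add_apply, bilin_concat_left]
    simp only [bilin_cons_left]
    abel
termination_by u.length + v.length

end WordAlgebra

/-! ### Permutations in one-line notation and standardization -/

/-- `w` is the one-line notation of a permutation of `{1, …, n}`, `n` the length of `w`. -/
def IsPerm (w : List ℕ) : Prop := w.Perm (List.range' 1 w.length)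

/-- The set of all permutations of all `[n]`, `n ≥ 0`, in one-line notation. -/
abbrev PermWord : Type := {w : List ℕ // IsPerm w}

/-- The number of entries of `w` that are at most `x`. -/
def rank (w : List ℕ) (x : ℕ) : ℕ := w.countP (fun y => decide (y ≤ x))

/-- The standardization of a word without repeated letters. -/
def st (w : List ℕ) : List ℕ := w.map (rank w)

@[simp] theorem length_st (w : List ℕ) : (st w).length = w.length := by simp [st]

theorem rank_perm {u v : List ℕ} (h : u.Perm v) : rank u = rank v := by
  funext x; exact h.countP_eq _

theorem rank_append (u v : List ℕ) (x : ℕ) : rank (u ++ v) x = rank u x + rank v x := by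
  simp [rank]

theorem rank_strictMono {w : List ℕ} {x y : ℕ} (hy : y ∈ w) (h : x < y) :
    rank w x < rank w y := by
  obtain ⟨l₁, l₂, rfl⟩ := List.append_of_mem hy
  have mono (l : List ℕ) : rank l x ≤ rank l y :=
    List.countP_mono_left (fun z _ hz => by simp at hz ⊢; omega)
  have h1 := mono l₁
  have h2 := mono l₂
  have e (z : ℕ) : rank (y :: l₂) z = rank l₂ z + if y ≤ z then 1 else 0 := by
    simp [rank, List.countP_cons]
  rw [rank_append, rank_append, e, e]
  simp only [le_refl, if_true]
  rw [if_neg (by omega)]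
  omega

theorem rank_le_iff {w : List ℕ} {x y : ℕ} (hx : x ∈ w) (hy : y ∈ w) :
    rank w x ≤ rank w y ↔ x ≤ y := by
  constructor
  · intro h
    by_contra hn
    exact absurd (rank_strictMono hx (not_le.mp hn)) (not_lt.mpr h)
  · intro h
    rcases h.eq_or_lt with rfl | h
    · exact le_rfl
    · exact (rank_strictMono hy h).le

theorem st_map {f : ℕ → ℕ} {w : List ℕ} (h : ∀ x ∈ w, ∀ y ∈ w, (f x ≤ f y ↔ x ≤ y)) :
    st (w.map f) = st w := by
  simp only [st, List.map_map]
  refine List.map_congr_left (fun x hx => ?_)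
  simp only [Function.comp, rank, List.countP_map]
  refine List.countP_congr (fun y hy => ?_)
  simpa using h y hy x hx

theorem st_map_rank {w p : List ℕ} (h : p ⊆ w) : st (p.map (rank w)) = st p :=
  st_map (fun _ hx _ hy => rank_le_iff (h hx) (h hy))

theorem st_shift (m : ℕ) (w : List ℕ) : st (w.map (· + m)) = st w :=
  st_map (fun _ _ _ _ => by simp)

theorem isPerm_st {w : List ℕ} (hw : w.Nodup) : IsPerm (st w) := by
  have hnd : (st w).Nodup := by
    refine (List.nodup_map_iff_inj_on hw).mpr (fun x hx y hy h => ?_)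
    exact le_antisymm ((rank_le_iff hx hy).mp h.le) ((rank_le_iff hy hx).mp h.ge)
  have hsub : st w ⊆ List.range' 1 (st w).length := by
    intro z hz
    obtain ⟨x, hx, rfl⟩ := List.mem_map.mp hz
    have h1 : 0 < rank w x := List.countP_pos_iff.mpr ⟨x, hx, by simp⟩
    have h2 : rank w x ≤ w.length := List.countP_le_length
    simp only [List.mem_range'_1, length_st]
    omega
  exact (List.subperm_of_subset hnd hsub).perm_of_length_le (by simp)

theorem IsPerm.nodup {w : List ℕ} (h : IsPerm w) : w.Nodup :=
  h.nodup_iff.mpr List.nodup_range'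

theorem IsPerm.mem {w : List ℕ} (h : IsPerm w) {x : ℕ} (hx : x ∈ w) : 1 ≤ x ∧ x ≤ w.length := by
  have := h.mem_iff.mp hx
  simp only [List.mem_range'_1] at this
  omega

theorem rank_range' (m n x : ℕ) (h1 : m ≤ x + 1) (h2 : x < m + n) :
    rank (List.range' m n) x = x + 1 - m := by
  induction n generalizing m with
  | zero => simp [rank]; omega
  | succ n ih =>
    have e (l : List ℕ) : rank (m :: l) x = rank l x + if m ≤ x then 1 else 0 := by
      simp [rank, List.countP_cons]
    rw [List.range'_succ, e]
    split_ifs with h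
    · rw [ih (m + 1) (by omega) (by omega)]; omega
    · have : rank (List.range' (m + 1) n) x = 0 := by
        rw [rank, List.countP_eq_zero]
        intro y hy
        simp only [List.mem_range'_1] at hy
        simp; omega
      rw [this]; omega

theorem IsPerm.st_eq {w : List ℕ} (h : IsPerm w) : st w = w := by
  have : w.map (rank w) = w.map id := by
    refine List.map_congr_left (fun x hx => ?_)
    have := h.mem hx
    rw [rank_perm h, rank_range' _ _ _ (by omega) (by omega)]
    simp
  simpa [st] using this

theorem isPerm_nil : IsPerm [] := by simp [IsPerm]

theorem isPerm_append_shift {u v : List ℕ} (hu : IsPerm u) (hv : IsPerm v) :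
    IsPerm (u ++ v.map (· + u.length)) := by
  unfold IsPerm at *
  have h2 : (v.map (· + u.length)).Perm (List.range' (1 + u.length) v.length) := by
    refine (hv.map _).trans (List.Perm.of_eq ?_)
    have := @List.map_add_range' u.length 1 v.length 1
    simpa [add_comm] using this
  refine (hu.append h2).trans (List.Perm.of_eq ?_)
  simp [List.range'_append_1]

theorem IsPerm.perm {u v : List ℕ} (hv : IsPerm v) (h : u.Perm v) : IsPerm u := by
  unfold IsPerm at *
  rw [h.length_eq]
  exact h.trans hv

instance : DecidablePred IsPerm := fun w =>
  inferInstanceAs (Decidable (w.Perm (List.range' 1 w.length)))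

/-! ### The Malvenuto–Reutenauer Hopf algebra -/

/-- The free `k`-module with basis the set of all permutations. -/
def SSym (k : Type*) [CommRing k] : Type _ := PermWord →₀ k

namespace SSym

variable {k : Type*} [CommRing k]

instance : AddCommGroup (SSym k) := inferInstanceAs (AddCommGroup (PermWord →₀ k))

instance : Module k (SSym k) := inferInstanceAs (Module k (PermWord →₀ k))

/-- A permutation as a basis element. -/
def F (π : PermWord) : SSym k := Finsupp.single π 1

/-- Linear extension of a function on permutations. -/
def lift {M : Type*} [AddCommGroup M] [Module k M] (f : PermWord → M) : SSym k →ₗ[k] M :=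
  Finsupp.linearCombination k f

@[simp] theorem lift_F {M : Type*} [AddCommGroup M] [Module k M] (f : PermWord → M)
    (π : PermWord) : lift (k := k) f (F π) = f π := by
  change Finsupp.linearCombination k f (Finsupp.single π 1) = f π
  simp

theorem hom_ext {M : Type*} [AddCommGroup M] [Module k M] {f g : SSym k →ₗ[k] M}
    (h : ∀ π, f (F π) = g (F π)) : f = g :=
  Finsupp.lhom_ext' (fun π => LinearMap.ext_ring (h π))

/-- The inclusion of `SSym` into `k⟨ℕ⟩`, sending a permutation to its one-line notation. -/
def toWords : SSym k →ₗ[k] Words k := lift (fun π => word π.1)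

/-- The basis element of a word which is a permutation (and `0` for all other words). -/
def ofWord (w : List ℕ) : SSym k := if h : IsPerm w then F ⟨w, h⟩ else 0

/-- Linear extension of `ofWord`. It is only used on combinations of permutations, where it
inverts `toWords`. -/
def ofWords : Words k →ₗ[k] SSym k := Finsupp.linearCombination k ofWord

/-- The shifted shuffle product: `π · σ = ∑ τ`, over `τ` in `π ⧢ (σ + m)`, `m` the length
of `π`. -/
def mulMap : SSym k →ₗ[k] SSym k →ₗ[k] SSym k :=
  lift (fun π => lift (fun σ => ofWords (shuffleWord π.1 (σ.1.map (· + π.1.length)))))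

/-- The coproduct: `Δ π = ∑ st(p) ⊗ st(s)`, over all factorizations `π = p s`. -/
def comulMap : SSym k →ₗ[k] SSym k ⊗[k] SSym k :=
  lift (fun π => splitSum π.1 (fun p s => ofWord (st p) ⊗ₜ[k] ofWord (st s)))

/-- The counit: the coefficient of the empty permutation. -/
def counitMap : SSym k →ₗ[k] k := lift (fun π => if π.1 = [] then 1 else 0)

instance : One (SSym k) := ⟨F ⟨[], isPerm_nil⟩⟩

instance : Mul (SSym k) := ⟨fun x y => mulMap x y⟩

theorem mul_def (x y : SSym k) : x * y = mulMap x y := rfl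

theorem one_def : (1 : SSym k) = F ⟨[], isPerm_nil⟩ := rfl

theorem ofWord_of {w : List ℕ} (h : IsPerm w) : (ofWord w : SSym k) = F ⟨w, h⟩ := by
  simp [ofWord, h]

@[simp] theorem ofWord_val (π : PermWord) : (ofWord π.1 : SSym k) = F π := ofWord_of π.2

@[simp] theorem ofWords_word (w : List ℕ) : ofWords (word w : Words k) = ofWord w := by
  simp [ofWords]

@[simp] theorem toWords_F (π : PermWord) : toWords (F π : SSym k) = word π.1 := by
  simp [toWords]

theorem ofWords_toWords (x : SSym k) : ofWords (toWords x) = x := by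
  have : (ofWords ∘ₗ toWords : SSym k →ₗ[k] SSym k) = LinearMap.id := hom_ext (by simp)
  exact congrArg (fun f => f x) this

theorem toWords_injective : Function.Injective (toWords : SSym k → Words k) :=
  Function.LeftInverse.injective ofWords_toWords

theorem F_mul_F (π σ : PermWord) :
    (F π * F σ : SSym k) = ofWords (shuffleWord π.1 (σ.1.map (· + π.1.length))) := by
  simp [mul_def, mulMap]

theorem toWords_F_mul_F (π σ : PermWord) :
    toWords (F π * F σ : SSym k) = shuffleWord π.1 (σ.1.map (· + π.1.length)) := by
  rw [F_mul_F]
  refine eq_on_shuffleWord (F := toWords ∘ₗ ofWords) (G := LinearMap.id) _ _ (fun w hw => ?_)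
  have h : IsPerm w := (isPerm_append_shift π.2 σ.2).perm hw
  simp [ofWord_of h]

theorem mul_assoc_F (π σ τ : PermWord) : (F π * F σ * F τ : SSym k) = F π * (F σ * F τ) := by
  apply toWords_injective
  have hl : toWords (F π * F σ * F τ : SSym k) =
      shuffle (shuffleWord π.1 (σ.1.map (· + π.1.length)))
        (word (τ.1.map (· + (π.1.length + σ.1.length)))) := by
    rw [F_mul_F]
    refine eq_on_shuffleWord (F := toWords ∘ₗ (mulMap.flip (F τ)) ∘ₗ ofWords)
      (G := shuffle.flip (word (τ.1.map (· + (π.1.length + σ.1.length))))) _ _ (fun w hw => ?_)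
    have h : IsPerm w := (isPerm_append_shift π.2 σ.2).perm hw
    have hlen : w.length = π.1.length + σ.1.length := by simpa using hw.length_eq
    have := toWords_F_mul_F (k := k) ⟨w, h⟩ τ
    simp only [hlen] at this
    simpa [ofWord_of h, mul_def] using this
  have hr : toWords (F π * (F σ * F τ) : SSym k) =
      shuffle (word π.1) (mapLetters (· + π.1.length)
        (shuffleWord σ.1 (τ.1.map (· + σ.1.length)))) := by
    rw [F_mul_F σ τ]
    refine eq_on_shuffleWord (F := toWords ∘ₗ (mulMap (F π)) ∘ₗ ofWords)
      (G := shuffle (word π.1) ∘ₗ mapLetters (· + π.1.length)) _ _ (fun w hw => ?_)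
    have h : IsPerm w := (isPerm_append_shift σ.2 τ.2).perm hw
    have := toWords_F_mul_F (k := k) π ⟨w, h⟩
    simpa [ofWord_of h, mul_def] using this
  rw [hl, hr, mapLetters_shuffleWord, ← shuffle_word, ← shuffle_word, shuffle_assoc]
  congr 3
  simp [Function.comp_def, add_comm, add_left_comm]

theorem induction_F {p : SSym k → Prop} (x : SSym k) (h0 : p 0)
    (hadd : ∀ x y, p x → p y → p (x + y)) (hF : ∀ (r : k) (π : PermWord), p (r • F π)) : p x := by
  refine Finsupp.induction_linear (motive := p) x h0 hadd (fun π r => ?_)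
  have : (Finsupp.single π r : PermWord →₀ k) = (r • F π : SSym k) := by
    change _ = r • (Finsupp.single π 1 : PermWord →₀ k)
    simp
  rw [this]; exact hF r π

theorem mul_assoc' (x y z : SSym k) : x * y * z = x * (y * z) := by
  induction x using induction_F with
  | h0 => simp [mul_def]
  | hadd x x' hx hx' => simp only [mul_def, map_add, LinearMap.add_apply] at *; rw [hx, hx']
  | hF r π =>
  induction y using induction_F with
  | h0 => simp [mul_def]
  | hadd y y' hy hy' => simp only [mul_def, map_add, LinearMap.add_apply] at *; rw [hy, hy']
  | hF s σ =>
  induction z using induction_F with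
  | h0 => simp [mul_def]
  | hadd z z' hz hz' => simp only [mul_def, map_add] at *; rw [hz, hz']
  | hF t τ =>
    have := mul_assoc_F (k := k) π σ τ
    simp only [mul_def] at this
    simp [mul_def, this]

theorem one_mul' (x : SSym k) : 1 * x = x := by
  have : (mulMap 1 : SSym k →ₗ[k] SSym k) = LinearMap.id :=
    hom_ext (fun π => by simp [mulMap, one_def])
  exact congrArg (fun f => f x) this

theorem mul_one' (x : SSym k) : x * 1 = x := by
  have : (mulMap.flip 1 : SSym k →ₗ[k] SSym k) = LinearMap.id :=
    hom_ext (fun π => by simp [mulMap, one_def])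
  exact congrArg (fun f => f x) this

instance : Ring (SSym k) :=
  { (inferInstance : AddCommGroup (SSym k)) with
    mul := (· * ·)
    one := 1
    mul_assoc := mul_assoc'
    one_mul := one_mul'
    mul_one := mul_one'
    left_distrib := fun x y z => map_add (mulMap x) y z
    right_distrib := fun x y z => by simp [mul_def]
    zero_mul := fun x => by simp [mul_def]
    mul_zero := fun x => by simp [mul_def] }

instance : Algebra k (SSym k) :=
  Algebra.ofModule (fun r x y => by simp [mul_def]) (fun r x y => by simp [mul_def])

theorem ofWord_st (π : PermWord) : (ofWord (st π.1) : SSym k) = F π := by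
  rw [π.2.st_eq, ofWord_val]

/-- `Δ(st w) = ∑ st(p) ⊗ st(s)`, over all factorizations `w = p s`. -/
theorem comulMap_st {w : List ℕ} (hw : w.Nodup) :
    comulMap (ofWord (st w) : SSym k) =
      splitSum w (fun p s => ofWord (st p) ⊗ₜ[k] ofWord (st s)) := by
  rw [ofWord_of (isPerm_st hw), comulMap, lift_F]
  change splitSum (w.map (rank w)) _ = _
  rw [splitSum_map]
  refine splitSum_congr (fun p s h => ?_)
  rw [st_map_rank, st_map_rank] <;> simp [← h]

theorem counitMap_st {w : List ℕ} (hw : w.Nodup) :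
    counitMap (ofWord (st w) : SSym k) = if w = [] then 1 else 0 := by
  rw [ofWord_of (isPerm_st hw), counitMap, lift_F]
  simp [st]

theorem splitSum_left {M : Type*} [AddCommMonoid M] (w : List ℕ) (g : List ℕ → List ℕ → M)
    (h : ∀ p s, p ++ s = w → p ≠ [] → g p s = 0) : splitSum w g = g [] w := by
  cases w with
  | nil => simp [splitSum_nil]
  | cons a w =>
    rw [splitSum_cons, splitSum_congr (h := fun _ _ => (0 : M)) (fun p s e => h _ _ (by simp [e])
      (by simp))]
    simp [splitSum]

theorem splitSum_right {M : Type*} [AddCommMonoid M] (w : List ℕ) (g : List ℕ → List ℕ → M)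
    (h : ∀ p s, p ++ s = w → s ≠ [] → g p s = 0) : splitSum w g = g w [] := by
  induction w generalizing g with
  | nil => simp [splitSum_nil]
  | cons a w ih =>
    rw [splitSum_cons, ih _ (fun p s e hs => h _ _ (by simp [e]) hs), h [] (a :: w) (by simp)
      (by simp), zero_add]

instance : CoalgebraStruct k (SSym k) where
  comul := comulMap
  counit := counitMap

theorem comul_def : (CoalgebraStruct.comul : SSym k →ₗ[k] _) = comulMap := rfl

theorem counit_def : (CoalgebraStruct.counit : SSym k →ₗ[k] _) = counitMap := rfl

theorem comulMap_F (π : PermWord) :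
    comulMap (F π : SSym k) = splitSum π.1 (fun p s => ofWord (st p) ⊗ₜ[k] ofWord (st s)) := by
  simp [comulMap]

theorem nodup_of_append {p s w : List ℕ} (h : p ++ s = w) (hw : w.Nodup) :
    p.Nodup ∧ s.Nodup := by
  subst h
  exact ⟨hw.of_append_left, hw.of_append_right⟩

instance : Coalgebra k (SSym k) where
  coassoc := by
    refine hom_ext (fun π => ?_)
    have hπ := π.2.nodup
    simp only [comul_def, LinearMap.comp_apply, comulMap_F, map_splitSum, LinearMap.rTensor_tmul,
      LinearMap.lTensor_tmul, LinearEquiv.coe_coe]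
    have h1 : splitSum π.1 (fun p s => (TensorProduct.assoc k (SSym k) (SSym k) (SSym k))
        (comulMap (ofWord (st p)) ⊗ₜ[k] ofWord (st s))) =
        splitSum π.1 (fun p s => splitSum p (fun p₁ p₂ =>
          ofWord (st p₁) ⊗ₜ[k] (ofWord (st p₂) ⊗ₜ[k] ofWord (st s)))) := by
      refine splitSum_congr (fun p s h => ?_)
      rw [comulMap_st (nodup_of_append h hπ).1]
      simp [splitSum, TensorProduct.sum_tmul]
    have h2 : splitSum π.1 (fun p s => (ofWord (st p) : SSym k) ⊗ₜ[k]
          comulMap (ofWord (st s) : SSym k)) =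
        splitSum π.1 (fun p s => splitSum s (fun s₁ s₂ =>
          ofWord (st p) ⊗ₜ[k] (ofWord (st s₁) ⊗ₜ[k] ofWord (st s₂)))) := by
      refine splitSum_congr (fun p s h => ?_)
      rw [comulMap_st (nodup_of_append h hπ).2]
      simp [splitSum, TensorProduct.tmul_sum]
    rw [h1, h2]
    exact splitSum_assoc _ _
  rTensor_counit_comp_comul := by
    refine hom_ext (fun π => ?_)
    have hπ := π.2.nodup
    simp only [comul_def, counit_def, LinearMap.comp_apply, comulMap_F, map_splitSum,
      LinearMap.rTensor_tmul]
    rw [splitSum_left]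
    · rw [counitMap_st (by simp), ofWord_st]; simp
    · intro p s h hp
      rw [counitMap_st (nodup_of_append h hπ).1]; simp [hp]
  lTensor_counit_comp_comul := by
    refine hom_ext (fun π => ?_)
    have hπ := π.2.nodup
    simp only [comul_def, counit_def, LinearMap.comp_apply, comulMap_F, map_splitSum,
      LinearMap.lTensor_tmul]
    rw [splitSum_right]
    · rw [counitMap_st (by simp), ofWord_st]; simp
    · intro p s h hs
      rw [counitMap_st (nodup_of_append h hπ).2]; simp [hs]

/-- If all letters of `p` are below those of `q`, then standardizing the words of `p ⧢ q` gives the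
product of `st p` and `st q`. -/
theorem lc_st_shuffleWord (p q : List ℕ) (h : ∀ x ∈ p, ∀ y ∈ q, x < y)
    (hp : p.Nodup) (hq : q.Nodup) :
    Finsupp.linearCombination k (fun w => (ofWord (st w) : SSym k)) (shuffleWord p q) =
      ofWord (st p) * ofWord (st q) := by
  rw [ofWord_of (isPerm_st hp), ofWord_of (isPerm_st hq), F_mul_F]
  have hp' : st p = p.map (rank (p ++ q)) := by
    refine List.map_congr_left (fun x hx => ?_)
    have : rank q x = 0 := by
      rw [rank, List.countP_eq_zero]
      intro y hy
      simpa using h x hx y hy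
    rw [rank_append, this, add_zero]
  have hq' : (st q).map (· + (st p).length) = q.map (rank (p ++ q)) := by
    rw [length_st, st, List.map_map]
    refine List.map_congr_left (fun y hy => ?_)
    have : rank p y = p.length := by
      rw [rank, List.countP_eq_length]
      intro x hx
      simpa using (h x hx y hy).le
    rw [rank_append, this, Function.comp, add_comm]
  change _ = ofWords (shuffleWord (st p) ((st q).map (· + (st p).length)))
  rw [hq', hp', ← mapLetters_shuffleWord]
  refine eq_on_shuffleWord (G := ofWords ∘ₗ mapLetters (rank (p ++ q))) _ _ (fun w hw => ?_)
  simp [st, rank_perm hw]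

theorem bilin_tmul (f g : List ℕ → SSym k) (x y : Words k) :
    bilin (fun p s => f p ⊗ₜ[k] g s) x y =
      Finsupp.linearCombination k f x ⊗ₜ[k] Finsupp.linearCombination k g y := by
  have : bilin (k := k) (fun p s => f p ⊗ₜ[k] g s) =
      (TensorProduct.mk k (SSym k) (SSym k)).compl₁₂ (Finsupp.linearCombination k f)
        (Finsupp.linearCombination k g) :=
    words_ext (fun u => words_ext (fun v => by simp))
  rw [this]; rfl

theorem comulMap_mul_F (π σ : PermWord) :
    comulMap (F π * F σ : SSym k) = comulMap (F π) * comulMap (F σ) := by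
  rw [F_mul_F]
  have h1 : comulMap (ofWords (shuffleWord π.1 (σ.1.map (· + π.1.length))) : SSym k) =
      Finsupp.linearCombination k (fun w => splitSum w (fun p s =>
        (ofWord (st p) : SSym k) ⊗ₜ[k] (ofWord (st s) : SSym k)))
        (shuffleWord π.1 (σ.1.map (· + π.1.length))) := by
    refine eq_on_shuffleWord (F := comulMap ∘ₗ ofWords) _ _ (fun w hw => ?_)
    have h : IsPerm w := (isPerm_append_shift π.2 σ.2).perm hw
    simp [ofWord_of h, comulMap_F]
  rw [h1, deconcat_shuffleWord, comulMap_F, comulMap_F]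
  have h2 (x : SSym k ⊗[k] SSym k) (w : List ℕ) (g : List ℕ → List ℕ → SSym k ⊗[k] SSym k) :
      x * splitSum w g = splitSum w (fun p s => x * g p s) := by
    simp [splitSum, Finset.mul_sum]
  have h3 (x : SSym k ⊗[k] SSym k) (w : List ℕ) (g : List ℕ → List ℕ → SSym k ⊗[k] SSym k) :
      splitSum w g * x = splitSum w (fun p s => g p s * x) := by
    simp [splitSum, Finset.sum_mul]
  rw [h3]
  refine splitSum_congr (fun p s hps => ?_)
  rw [h2, splitSum_map]
  refine splitSum_congr (fun q t hqt => ?_)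
  obtain ⟨hp, hs⟩ := nodup_of_append hps π.2.nodup
  obtain ⟨hq, ht⟩ := nodup_of_append hqt σ.2.nodup
  have inj : Function.Injective (· + π.1.length) := add_left_injective _
  have lt (x y : ℕ) (hx : x ∈ π.1) (hy : y ∈ σ.1) : x < y + π.1.length := by
    have := π.2.mem hx
    have := σ.2.mem hy
    omega
  rw [bilin_tmul, lc_st_shuffleWord, lc_st_shuffleWord, st_shift, st_shift,
    Algebra.TensorProduct.tmul_mul_tmul]
  · intro x hx y hy
    obtain ⟨z, hz, rfl⟩ := List.mem_map.mp hy
    exact lt x z (hps ▸ List.mem_append_right _ hx) (hqt ▸ List.mem_append_right _ hz)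
  · exact hs
  · exact ht.map inj
  · intro x hx y hy
    obtain ⟨z, hz, rfl⟩ := List.mem_map.mp hy
    exact lt x z (hps ▸ List.mem_append_left _ hx) (hqt ▸ List.mem_append_left _ hz)
  · exact hp
  · exact hq.map inj

theorem counitMap_mul_F (π σ : PermWord) :
    counitMap (F π * F σ : SSym k) = counitMap (F π) * counitMap (F σ) := by
  rw [F_mul_F]
  have h1 : counitMap (ofWords (shuffleWord π.1 (σ.1.map (· + π.1.length))) : SSym k) =
      Finsupp.linearCombination k (fun w => if w = [] then (1 : k) else 0)
        (shuffleWord π.1 (σ.1.map (· + π.1.length))) := by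
    refine eq_on_shuffleWord (F := counitMap ∘ₗ ofWords) _ _ (fun w hw => ?_)
    have h : IsPerm w := (isPerm_append_shift π.2 σ.2).perm hw
    simp [ofWord_of h, counitMap]
  have h2 : Finsupp.linearCombination k (fun w : List ℕ => if w = [] then (1 : k) else 0)
        (shuffleWord π.1 (σ.1.map (· + π.1.length))) =
      Finsupp.linearCombination k
        (fun _ : List ℕ => if π.1 = [] ∧ σ.1 = [] then (1 : k) else 0)
        (shuffleWord π.1 (σ.1.map (· + π.1.length))) := by
    refine eq_on_shuffleWord _ _ (fun w hw => ?_)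
    have : w = [] ↔ π.1 = [] ∧ σ.1 = [] := by
      rw [← List.length_eq_zero_iff, hw.length_eq]; simp
    simp [this]
  rw [h1, h2]
  rcases eq_or_ne π.1 [] with hπ | hπ
  · rw [hπ]; simp [counitMap, hπ]
  · simp [counitMap, hπ, Finsupp.linearCombination_apply]

instance : Bialgebra k (SSym k) where
  counit_one := by simp [counit_def, counitMap, one_def]
  mul_compr₂_counit := by
    refine hom_ext (fun π => hom_ext (fun σ => ?_))
    exact counitMap_mul_F π σ
  comul_one := by
    rw [comul_def, one_def, comulMap_F, splitSum_nil]
    have : (ofWord (st []) : SSym k) = 1 := ofWord_of isPerm_nil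
    rw [this]; rfl
  mul_compr₂_comul := by
    refine hom_ext (fun π => hom_ext (fun σ => ?_))
    exact comulMap_mul_F π σ

/-- The antipode on a permutation `w ∈ 𝔖ₙ`, by the recursion
`S(w) = - ∑_{i < n} S(st(w₁ ⋯ wᵢ)) · st(wᵢ₊₁ ⋯ wₙ)` for `n ≥ 1`, and `S(∅) = ∅`. -/
def antipodeWord (w : List ℕ) : SSym k :=
  if w = [] then 1
  else - ∑ i : Fin w.length, antipodeWord (st (w.take i)) * ofWord (st (w.drop i))
termination_by w.length
decreasing_by simp

/-- The linear extension of `antipodeWord`. -/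
def antipodeMap : SSym k →ₗ[k] SSym k := lift (fun π => antipodeWord π.1)

/-- The same with the roles of the two tensor factors exchanged. It serves to show that
`antipodeMap` is a two-sided convolution inverse of the identity. -/
def antipodeWordRight (w : List ℕ) : SSym k :=
  if w = [] then 1
  else - ∑ i : Fin w.length, ofWord (st (w.take (i + 1))) * antipodeWordRight (st (w.drop (i + 1)))
termination_by w.length
decreasing_by
  have := i.2
  rw [length_st, List.length_drop]
  omega

theorem lift_st {M : Type*} [AddCommGroup M] [Module k M] (f : List ℕ → M) {w : List ℕ}
    (hw : w.Nodup) : lift (k := k) (fun π => f π.1) (ofWord (st w)) = f (st w) := by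
  rw [ofWord_of (isPerm_st hw), lift_F]

theorem ofWord_nil : (ofWord (st []) : SSym k) = 1 := ofWord_of isPerm_nil

theorem antipode_left :
    LinearMap.mul' k (SSym k) ∘ₗ antipodeMap.rTensor (SSym k) ∘ₗ comulMap =
      Algebra.linearMap k (SSym k) ∘ₗ counitMap := by
  refine hom_ext (fun π => ?_)
  simp only [LinearMap.comp_apply, comulMap_F, map_splitSum, LinearMap.rTensor_tmul,
    LinearMap.mul'_apply]
  rw [splitSum_congr (h := fun p s => antipodeWord (st p) * ofWord (st s)) (fun p s h => by
    rw [antipodeMap, lift_st _ (nodup_of_append h π.2.nodup).1]), splitSum,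
    Finset.sum_range_succ, Finset.sum_range]
  simp only [List.take_length, List.drop_length, ofWord_nil, mul_one, π.2.st_eq]
  rw [antipodeWord.eq_1 π.1, counitMap, lift_F]
  split_ifs with h
  · simp [h]
  · simp

theorem antipode_right :
    LinearMap.mul' k (SSym k) ∘ₗ
        (lift (k := k) (fun π => antipodeWordRight π.1)).lTensor (SSym k) ∘ₗ comulMap =
      Algebra.linearMap k (SSym k) ∘ₗ counitMap := by
  refine hom_ext (fun π => ?_)
  simp only [LinearMap.comp_apply, comulMap_F, map_splitSum, LinearMap.lTensor_tmul,
    LinearMap.mul'_apply]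
  rw [splitSum_congr (h := fun p s => ofWord (st p) * antipodeWordRight (st s)) (fun p s h => by
    rw [lift_st _ (nodup_of_append h π.2.nodup).2]), splitSum,
    Finset.sum_range_succ', Finset.sum_range]
  simp only [List.take_zero, List.drop_zero, ofWord_nil, one_mul, π.2.st_eq]
  rw [antipodeWordRight.eq_1 π.1, counitMap, lift_F]
  split_ifs with h
  · simp [h]
  · simp

theorem antipodeMap_eq :
    (antipodeMap : SSym k →ₗ[k] SSym k) = lift (fun π => antipodeWordRight π.1) := by
  have hl : WithConv.toConv (antipodeMap : SSym k →ₗ[k] SSym k) *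
      WithConv.toConv (LinearMap.id : SSym k →ₗ[k] SSym k) = 1 := by
    rw [LinearMap.convMul_def, LinearMap.convOne_def]
    exact congrArg WithConv.toConv antipode_left
  have hr : WithConv.toConv (LinearMap.id : SSym k →ₗ[k] SSym k) *
      WithConv.toConv (lift (k := k) (fun π => (antipodeWordRight π.1 : SSym k))) = 1 := by
    rw [LinearMap.convMul_def, LinearMap.convOne_def]
    exact congrArg WithConv.toConv antipode_right
  have h := left_inv_eq_right_inv hl hr
  exact WithConv.toConv_injective h

instance : HopfAlgebra k (SSym k) where
  antipode := antipodeMap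
  mul_antipode_rTensor_comul := antipode_left
  mul_antipode_lTensor_comul := by
    rw [antipodeMap_eq]
    exact antipode_right

end SSym

/-! ### The permutations and the notation of the antipode formulas -/

infixl:67 " ⧢ " => shuffle

infixl:75 " ⬝ " => concat

/-- The word `k (k+1) ⋯ l`, empty if `l < k`. -/
def etaWord (k l : ℕ) : List ℕ := List.range' k (l + 1 - k)

/-- The permutation word `a b 1 ⋯ (b-1) (b+1) ⋯ (a-1) (a+1) ⋯ n`. -/
def sigmaWord (n a b : ℕ) : List ℕ :=
  [a, b] ++ etaWord 1 (b - 1) ++ etaWord (b + 1) (a - 1) ++ etaWord (a + 1) n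

theorem isPerm_sigmaWord {n a b : ℕ} (hb : 1 ≤ b) (hba : b < a) (han : a ≤ n) :
    IsPerm (sigmaWord n a b) := by
  have hlen : (sigmaWord n a b).length = n := by
    simp [sigmaWord, etaWord]; omega
  rw [IsPerm, hlen]
  have h1 : List.range' 1 n = etaWord 1 (b - 1) ++ b :: etaWord (b + 1) (a - 1) ++
      a :: etaWord (a + 1) n := by
    simp only [etaWord, ← List.range'_succ]
    rw [show a - 1 + 1 - (b + 1) + 1 = a - b by omega,
      show n + 1 - (a + 1) + 1 = n + 1 - a by omega]
    have e1 : List.range' 1 (b - 1 + 1 - 1) ++ List.range' b (a - b) = List.range' 1 (a - 1) := by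
      have := @List.range'_append_1 1 (b - 1) (a - b)
      rw [show 1 + (b - 1) = b by omega, show b - 1 + (a - b) = a - 1 by omega] at this
      rw [← this]; congr 2
    rw [e1]
    have := @List.range'_append_1 1 (a - 1) (n + 1 - a)
    rw [show 1 + (a - 1) = a by omega, show a - 1 + (n + 1 - a) = n by omega] at this
    exact this.symm
  rw [h1]
  simp only [sigmaWord, List.cons_append, List.nil_append, List.append_assoc]
  refine List.Perm.trans ?_ (List.perm_middle (a := b)).symm
  refine (List.Perm.swap b a _).trans (List.Perm.cons b ?_)
  rw [← List.append_assoc, ← List.append_assoc]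
  exact (List.perm_middle (a := a)).symm

/-- The permutation `σ_A = a b 1 ⋯ (b-1) (b+1) ⋯ (a-1) (a+1) ⋯ n` of `[n]` for `A = {a, b}`,
`1 ≤ b < a ≤ n`. -/
def sigma (n a b : ℕ) (hb : 1 ≤ b) (hba : b < a) (han : a ≤ n) : PermWord :=
  ⟨sigmaWord n a b, isPerm_sigmaWord hb hba han⟩

section Formulas

variable {k : Type*} [CommRing k]

/-- `η_{i,l}`: the increasing word `i (i+1) ⋯ l` if `i ≤ l`, the empty word if `i = l + 1`, and
`0` if `i ≥ l + 2`. -/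
def eta (i l : ℕ) : Words k := if l + 2 ≤ i then 0 else word (etaWord i l)

/-- `δ_{l,i}`: the decreasing word `l (l-1) ⋯ i` if `i ≤ l`, the empty word if `i = l + 1`, and
`0` if `i ≥ l + 2`. -/
def delta (l i : ℕ) : Words k := if l + 2 ≤ i then 0 else word (etaWord i l).reverse

/-- The part of `x` made of the words ending in `j`, with this last letter removed. -/
def endStar (j : ℕ) : Words k →ₗ[k] Words k :=
  Finsupp.linearCombination k
    (fun w => if w.getLast? = some j then word w.dropLast else 0)

variable (k) in
/-- `S(π)_j^*`: the part of the antipode of the permutation `π` made of the words ending in `j`,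
with this last letter removed. -/
def antipodeStar (π : PermWord) (j : ℕ) : Words k :=
  endStar j (SSym.toWords (HopfAlgebra.antipode k (SSym.F π : SSym k)))

end Formulas

end MalvenutoReutenauer

end

open MalvenutoReutenauer

noncomputable section

/-!
The antipode satisfies `S(σ) = - ∑ S(st(p)) · st(s)`, over the factorizations `σ = p s` with `s`
nonempty. The word `σ_A` increases from its third letter on, so `st(s)` is an identity permutation
as soon as `p` has at least two letters. In the ring of power series over `SSym`, the series of the
identity permutations has as inverse the series of the decreasing permutations with alternating
signs (`sum_antidiagonal_identity_mul_reverse`), and solving the recursion gives the closed formula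

  `S(σ_A) = ∑_{i = 2}^{n} (-1)^{n+i+1} (σ^{(i)} - 1 ⧢ τ^{(i)}) ⧢ δ_{n,i+1}`

(`toWords_antipodeWord`, `toWords_antipode_sigma`). Here `σ^{(i)}` is the standardization of the
prefix of length `i` of `σ_A`, and `τ^{(i)}` that of the same prefix without its first letter,
shifted by one.

The map `x ↦ x_j^*` is a derivation for the shuffle product (`endStar_shuffle`). Applied to the
closed formula it gives three sums, according to which factor the last letter comes from, and a
fourth one for the letter `1` when `j = 1`. The last letters of `σ^{(i)}`, `τ^{(i)}` and
`δ_{n,i+1}` are explicit, so for `j ≥ 3` each sum has at most one nonzero term; which one it is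
depends on the position of `j` relative to `b` and `a`. For `j = 1` all `τ^{(i)}` contribute, and
those with `i > b` telescope (`sum_eta_shuffle_delta`).
-/

namespace MalvenutoReutenauer
open SSym

variable {k : Type*} [CommRing k]

/-! ### Last letters of shuffles -/

theorem concat_assoc (x y z : Words k) : (x ⬝ y) ⬝ z = x ⬝ (y ⬝ z) := by
  induction x using Finsupp.induction_linear with
  | zero => simp
  | add x x' hx hx' => simp only [map_add, LinearMap.add_apply, hx, hx']
  | single u r =>
  induction y using Finsupp.induction_linear with
  | zero => simp
  | add y y' hy hy' => simp only [map_add, LinearMap.add_apply, hy, hy']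
  | single v s =>
  induction z using Finsupp.induction_linear with
  | zero => simp
  | add z z' hz hz' => simp only [map_add, hz, hz']
  | single w t =>
    have h (u : List ℕ) (r : k) : (Finsupp.single u r : Words k) = r • word u := by simp [word]
    rw [h u, h v, h w]
    simp

/-- The shuffle product can be computed from the last letters as well as from the first ones. -/
theorem shuffleWord_append_singleton (x y : ℕ) (u v : List ℕ) :
    (shuffleWord (u ++ [x]) (v ++ [y]) : Words k) =
      shuffleWord u (v ++ [y]) ⬝ word [x] + shuffleWord (u ++ [x]) v ⬝ word [y] := by
  match u, v with
  | [], [] => simp [shuffleWord_cons_cons, add_comm]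
  | [], b :: v =>
    have ih := shuffleWord_append_singleton x y [] v
    simp only [List.nil_append, List.cons_append, shuffleWord_cons_cons, shuffleWord_nil_left] at *
    rw [ih]
    simp only [map_add, LinearMap.add_apply, concat_assoc, concat_word]
    simp only [List.cons_append, List.nil_append]
    abel
  | a :: u, [] =>
    have ih := shuffleWord_append_singleton x y u []
    simp only [List.nil_append, List.cons_append, shuffleWord_cons_cons, shuffleWord_nil_right] at *
    rw [ih]
    simp only [map_add, LinearMap.add_apply, concat_assoc, concat_word]
    simp only [List.cons_append, List.nil_append]
    abel
  | a :: u, b :: v =>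
    have i1 := shuffleWord_append_singleton x y u (b :: v)
    have i2 := shuffleWord_append_singleton x y (a :: u) v
    simp only [List.cons_append, shuffleWord_cons_cons] at *
    rw [i1, i2]
    simp only [map_add, LinearMap.add_apply, concat_assoc]
    abel
termination_by u.length + v.length

theorem endStar_concat_singleton (j x : ℕ) (y : Words k) :
    endStar j (y ⬝ word [x]) = if x = j then y else 0 := by
  have : endStar j ∘ₗ (concat (k := k)).flip (word [x]) =
      if x = j then LinearMap.id else 0 := words_ext (fun u => by
    by_cases h : x = j <;> simp [endStar, h])
  have := congrArg (fun f => f y) this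
  split_ifs at this ⊢ <;> simpa using this

@[simp] theorem endStar_word_nil (j : ℕ) : endStar j (word [] : Words k) = 0 := by
  simp [endStar]

theorem endStar_word_append_singleton (j x : ℕ) (u : List ℕ) :
    endStar j (word (u ++ [x]) : Words k) = if x = j then word u else 0 := by
  rw [← concat_word, endStar_concat_singleton]

/-- Removing a last letter `j` is a derivation of the shuffle algebra. -/
theorem endStar_shuffle (j : ℕ) (x y : Words k) :
    endStar j (x ⧢ y) = endStar j x ⧢ y + x ⧢ endStar j y := by
  induction x using Finsupp.induction_linear with
  | zero => simp
  | add x x' hx hx' => simp only [map_add, LinearMap.add_apply, hx, hx']; abel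
  | single u r =>
  induction y using Finsupp.induction_linear with
  | zero => simp
  | add y y' hy hy' => simp only [map_add, hy, hy']; abel
  | single v s =>
    have h (u : List ℕ) (r : k) : (Finsupp.single u r : Words k) = r • word u := by simp [word]
    rw [h u, h v]
    have : endStar j (word u ⧢ word v : Words k) =
        endStar j (word u) ⧢ word v + word u ⧢ endStar j (word v) := by
      rcases u.eq_nil_or_concat with rfl | ⟨u, x, rfl⟩
      · simp [shuffle_nil_left]
      rcases v.eq_nil_or_concat with rfl | ⟨v, y, rfl⟩
      · simp [shuffle_nil_right]
      rw [List.concat_eq_append, List.concat_eq_append, endStar_word_append_singleton,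
        endStar_word_append_singleton, shuffle_word,
        shuffleWord_append_singleton, map_add, endStar_concat_singleton, endStar_concat_singleton]
      split_ifs <;> simp
    simp only [map_smul, LinearMap.smul_apply, this, smul_add]

/-! ### Increasing and decreasing words -/

theorem etaWord_eq_nil {i l : ℕ} (h : l < i) : etaWord i l = [] := by
  simp [etaWord]; omega

theorem etaWord_cons {i l : ℕ} (h : i ≤ l) : etaWord i l = i :: etaWord (i + 1) l := by
  rw [etaWord, show l + 1 - i = (l + 1 - (i + 1)) + 1 by omega, List.range'_succ]; rfl

theorem etaWord_append_singleton {i l : ℕ} (h : i ≤ l + 1) :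
    etaWord i (l + 1) = etaWord i l ++ [l + 1] := by
  rw [etaWord, etaWord, show l + 1 + 1 - i = (l + 1 - i) + 1 by omega, List.range'_1_concat]
  congr 2; omega

theorem etaWord_append_etaWord {i l m : ℕ} (h1 : i ≤ l + 1) (h2 : l ≤ m) :
    etaWord i l ++ etaWord (l + 1) m = etaWord i m := by
  have := @List.range'_append_1 i (l + 1 - i) (m - l)
  rw [show i + (l + 1 - i) = l + 1 by omega, show l + 1 - i + (m - l) = m + 1 - i by omega] at this
  rw [etaWord, etaWord, etaWord, ← this, show m + 1 - (l + 1) = m - l by omega]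

theorem mem_etaWord {x i l : ℕ} : x ∈ etaWord i l ↔ i ≤ x ∧ x ≤ l := by
  simp only [etaWord, List.mem_range'_1]; omega

theorem map_add_etaWord (c i l : ℕ) : (etaWord i l).map (· + c) = etaWord (i + c) (l + c) := by
  have := @List.map_add_range' c i (l + 1 - i) 1
  rw [etaWord, etaWord, show l + c + 1 - (i + c) = l + 1 - i by omega, add_comm i c, ← this]
  simp [add_comm]

@[simp] theorem length_etaWord (i l : ℕ) : (etaWord i l).length = l + 1 - i := by simp [etaWord]

theorem eta_of_le {i l : ℕ} (h : i ≤ l + 1) : (eta i l : Words k) = word (etaWord i l) :=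
  if_neg (by omega)

theorem delta_of_le {l i : ℕ} (h : i ≤ l + 1) :
    (delta l i : Words k) = word (etaWord i l).reverse := if_neg (by omega)

theorem delta_eq_concat {l i : ℕ} (h : i ≤ l) :
    (delta l i : Words k) = delta l (i + 1) ⬝ word [i] := by
  rw [delta_of_le (by omega), delta_of_le (by omega), etaWord_cons h]; simp

theorem delta_self_succ (l : ℕ) : (delta l (l + 1) : Words k) = word [] := by
  rw [delta_of_le le_rfl, etaWord_eq_nil (by omega)]; rfl

theorem delta_self_add_two (l : ℕ) : (delta l (l + 2) : Words k) = 0 := if_pos le_rfl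

theorem delta_succ_self (i : ℕ) : (delta (i + 1) i : Words k) = word [i + 1, i] := by
  rw [delta_of_le (by omega), etaWord_cons (by omega), etaWord_cons le_rfl,
    etaWord_eq_nil (by omega)]
  rfl

theorem endStar_delta (j : ℕ) {l i : ℕ} (h : i ≤ l + 1) :
    endStar j (delta l i : Words k) = if i = j then delta l (i + 1) else 0 := by
  rcases h.lt_or_eq with h | rfl
  · rw [delta_eq_concat (by omega), endStar_concat_singleton]
  · simp [delta_self_succ, delta_self_add_two]

/-- The last-letter recursion for `u x ⧢ δ_{n,i}`. It holds for `i = n + 1` too, where `δ_{n,n+1}`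
is empty and `δ_{n,n+2} = 0`. -/
theorem word_append_singleton_shuffle_delta (u : List ℕ) (x : ℕ) {n i : ℕ} (h : i ≤ n + 1) :
    word (u ++ [x]) ⧢ (delta n i : Words k) =
      (word u ⧢ delta n i) ⬝ word [x] + (word (u ++ [x]) ⧢ delta n (i + 1)) ⬝ word [i] := by
  rcases h.lt_or_eq with h | rfl
  · rw [delta_of_le h.le, delta_of_le (by omega), etaWord_cons (by omega)]
    simp [shuffleWord_append_singleton]
  · simp [delta_self_succ, delta_self_add_two, shuffle_nil_right]

theorem sum_Icc_eq_add_sum {M : Type*} [AddCommMonoid M] (f : ℕ → M) {l n : ℕ} (h : l ≤ n) :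
    ∑ i ∈ Finset.Icc l n, f i = f l + ∑ i ∈ Finset.Icc (l + 1) n, f i := by
  rw [← Finset.insert_Icc_add_one_left_eq_Icc h, Finset.sum_insert (by simp)]

theorem neg_one_pow_succ (m : ℕ) : (-1 : k) ^ (m + 1) = -(-1) ^ m := by
  rw [pow_succ, mul_neg_one]

/-- In the alternating sum of the `u x η_{l+1,i} ⧢ δ_{n,i+1}`, the words whose last letter comes
from `η` in one term and from `δ` in the preceding one cancel. Only words ending in `x` remain. -/
theorem sum_eta_shuffle_delta (u : List ℕ) (x : ℕ) {l n : ℕ} (h : l ≤ n) :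
    ∑ i ∈ Finset.Icc l n, (-1 : k) ^ (n + i) •
        (word (u ++ [x] ++ etaWord (l + 1) i) ⧢ (delta n (i + 1) : Words k)) =
      (-1 : k) ^ (n + l) • ((word u ⧢ delta n (l + 1)) ⬝ word [x]) := by
  obtain ⟨d, rfl⟩ := Nat.exists_eq_add_of_le h
  induction d generalizing u x l with
  | zero => simp [etaWord_eq_nil, delta_self_succ, shuffle_nil_right]
  | succ d ih =>
    -- After the first summand, `l + 1` is the first letter of `η` and takes the role of `x`.
    have ih := ih (u ++ [x]) (l + 1) (l := l + 1) (by omega)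
    rw [sum_Icc_eq_add_sum _ h]
    rw [etaWord_eq_nil (by omega), List.append_nil, word_append_singleton_shuffle_delta _ _
      (by omega)]
    rw [show l + 1 + d = l + (d + 1) by omega] at ih
    rw [Finset.sum_congr rfl (g := fun i => (-1 : k) ^ (l + (d + 1) + i) •
        (word (u ++ [x] ++ [l + 1] ++ etaWord (l + 1 + 1) i) ⧢ delta (l + (d + 1)) (i + 1)))
        (fun i hi => by
          rw [etaWord_cons (Finset.mem_Icc.mp hi).1]; simp), ih]
    rw [← add_assoc _ l 1, pow_succ]
    simp

/-- The case without a letter `x` in front: the increasing and the signed decreasing words are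
inverse to each other. -/
theorem sum_eta_shuffle_delta_eq_zero {l n : ℕ} (h : l < n) :
    ∑ i ∈ Finset.Icc l n, (-1 : k) ^ (n + i) •
        (word (etaWord (l + 1) i) ⧢ (delta n (i + 1) : Words k)) = 0 := by
  rw [sum_Icc_eq_add_sum _ h.le]
  rw [Finset.sum_congr rfl (g := fun i => (-1 : k) ^ (n + i) •
        (word ([] ++ [l + 1] ++ etaWord (l + 1 + 1) i) ⧢ delta n (i + 1)))
        (fun i hi => by
          rw [etaWord_cons (Finset.mem_Icc.mp hi).1]; simp), sum_eta_shuffle_delta _ _ h,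
      etaWord_eq_nil (by omega), shuffle_nil_left, shuffle_nil_left, ← delta_eq_concat h,
      Nat.succ_eq_add_one, ← add_assoc, pow_succ]
  simp

/-! ### Standardization -/

/-- A map which preserves the order of the letters of `w` and makes `w` a permutation computes its
standardization. -/
theorem st_eq_map {f : ℕ → ℕ} {w : List ℕ} (h : ∀ x ∈ w, ∀ y ∈ w, (f x ≤ f y ↔ x ≤ y))
    (hp : IsPerm (w.map f)) : st w = w.map f := by
  rw [← st_map h, hp.st_eq]

theorem isPerm_etaWord (m : ℕ) : IsPerm (etaWord 1 m) := by
  simp [IsPerm, etaWord]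

theorem isPerm_reverse_etaWord (m : ℕ) : IsPerm (etaWord 1 m).reverse :=
  (isPerm_etaWord m).perm (List.reverse_perm _)

theorem st_of_pairwise_lt {w : List ℕ} (h : w.Pairwise (· < ·)) : st w = etaWord 1 w.length := by
  have hp := isPerm_st (h.imp ne_of_lt)
  have hs : (st w).Pairwise (· < ·) :=
    List.pairwise_map.mpr (h.imp_of_mem fun _ hb hab => rank_strictMono hb hab)
  have := hp
  rw [IsPerm, length_st] at this
  simpa [etaWord] using this.eq_of_pairwise' hs List.pairwise_lt_range'

theorem st_take_st (w : List ℕ) (i : ℕ) : st ((st w).take i) = st (w.take i) := by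
  rw [show (st w).take i = (w.take i).map (rank w) from List.map_take.symm]
  exact st_map_rank (List.take_subset _ _)

theorem st_drop_st (w : List ℕ) (i : ℕ) : st ((st w).drop i) = st (w.drop i) := by
  rw [show (st w).drop i = (w.drop i).map (rank w) from List.map_drop.symm]
  exact st_map_rank (List.drop_subset _ _)

/-! ### Antipodes of words increasing from the third letter on -/

theorem toWords_ofWord_mul_ofWord {u v : List ℕ} (hu : IsPerm u) (hv : IsPerm v) :
    toWords (ofWord u * ofWord v : SSym k) = word u ⧢ word (v.map (· + u.length)) := by
  rw [ofWord_of hu, ofWord_of hv, toWords_F_mul_F, shuffle_word]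

theorem toWords_ofWord_mul_mul {u v w : List ℕ} (hu : IsPerm u) (hv : IsPerm v) (hw : IsPerm w) :
    toWords (ofWord u * ofWord v * ofWord w : SSym k) =
      word u ⧢ word (v.map (· + u.length)) ⧢ word (w.map (· + (u.length + v.length))) := by
  rw [ofWord_of hu, ofWord_of hv, ofWord_of hw, F_mul_F]
  simp only [shuffle_word]
  refine eq_on_shuffleWord (F := toWords ∘ₗ (mulMap.flip (F ⟨w, hw⟩)) ∘ₗ ofWords)
    (G := shuffle.flip (word (w.map (· + (u.length + v.length))))) _ _ (fun x hx => ?_)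
  have h : IsPerm x := (isPerm_append_shift hu hv).perm hx
  have hlen : x.length = u.length + v.length := by simpa using hx.length_eq
  have := toWords_F_mul_F (k := k) ⟨x, h⟩ ⟨w, hw⟩
  simp only [hlen] at this
  simpa [ofWord_of h, mul_def] using this

/-- In `SSym` the series of the identity permutations is inverse to the signed series of the
reversed ones. -/
theorem sum_antidiagonal_identity_mul_reverse (m : ℕ) :
    ∑ p ∈ Finset.HasAntidiagonal.antidiagonal m, (ofWord (etaWord 1 p.1) : SSym k) *
      ((-1 : k) ^ p.2 • ofWord (etaWord 1 p.2).reverse) = if m = 0 then 1 else 0 := by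
  rcases m.eq_zero_or_pos with rfl | hm
  · simp [etaWord, ofWord_of isPerm_nil, ← one_def]
  apply toWords_injective
  rw [if_neg hm.ne', map_zero, map_sum, ← sum_eta_shuffle_delta_eq_zero hm,
    Finset.Nat.sum_antidiagonal_eq_sum_range_succ_mk, Finset.range_eq_Ico, Nat.succ_eq_add_one,
    ← Finset.Ico_add_one_right_eq_Icc]
  refine Finset.sum_congr rfl fun i hi => ?_
  have hi := Finset.mem_Ico.mp hi
  simp only
  rw [mul_smul_comm, map_smul, toWords_ofWord_mul_ofWord (isPerm_etaWord _)
    (isPerm_reverse_etaWord _), delta_of_le (by omega), List.map_reverse, map_add_etaWord]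
  congr 1
  · rw [show m + i = m - i + 2 * i by omega, pow_add, pow_mul]; simp
  · rw [length_etaWord, show 1 + (i + 1 - 1) = i + 1 by omega,
      show m - i + (i + 1 - 1) = m by omega]

/-- If `D` is a right inverse of `E`, then `T = (T E) D` in the ring of power series, read off
coefficientwise. -/
theorem eq_sum_of_convolution {R : Type*} [Ring R] (E D : ℕ → R)
    (hED : ∀ m, ∑ p ∈ Finset.HasAntidiagonal.antidiagonal m, E p.1 * D p.2 = if m = 0 then 1 else 0)
    (T : ℕ → R) (m : ℕ) :
    T m = ∑ p ∈ Finset.HasAntidiagonal.antidiagonal m,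
      (∑ q ∈ Finset.HasAntidiagonal.antidiagonal p.1, T q.1 * E q.2) * D p.2 := by
  have h : PowerSeries.mk E * PowerSeries.mk D = 1 := by
    ext m
    simp [PowerSeries.coeff_mul, PowerSeries.coeff_one, hED]
  have := congrArg (PowerSeries.coeff m) (mul_assoc (PowerSeries.mk T) (PowerSeries.mk E)
    (PowerSeries.mk D))
  rw [h, mul_one] at this
  simpa [PowerSeries.coeff_mul] using this.symm

theorem antipodeWord_singleton : (antipodeWord [1] : SSym k) = - ofWord [1] := by
  rw [antipodeWord]
  simp [st, rank, antipodeWord.eq_1 []]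

/-- The antipode recursion for the prefix of length `m + 2` of a word which increases from its third
letter on. The factors with a prefix of length at least two have an identity permutation on the
right; those with a prefix of length zero or one make up the right hand side. -/
theorem sum_antipodeWord_mul_identity {w : List ℕ} (hw : w.Nodup)
    (hs : (w.drop 2).Pairwise (· < ·)) {m : ℕ} (hm : m + 2 ≤ w.length) :
    ∑ q ∈ Finset.HasAntidiagonal.antidiagonal m, (antipodeWord (st (w.take (q.1 + 2))) : SSym k) *
        ofWord (etaWord 1 q.2) =
      - (ofWord (st (w.take (m + 2))) - ofWord [1] * ofWord (st ((w.take (m + 2)).drop 1))) := by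
  set v := w.take (m + 2) with hv
  have hlen : v.length = m + 2 := by simp [hv, hm]
  have hvn : v.Nodup := hw.sublist (List.take_sublist _ _)
  have hp := isPerm_st hvn
  have key : (antipodeWord (st v) : SSym k) =
      - ∑ i ∈ Finset.range (m + 2), antipodeWord (st (v.take i)) * ofWord (st (v.drop i)) := by
    rw [antipodeWord, if_neg (by rw [← List.length_eq_zero_iff]; simp [hlen])]
    simp only [st_take_st, st_drop_st]
    rw [Fin.sum_univ_eq_sum_range
      (fun i => (antipodeWord (st (v.take i)) : SSym k) * ofWord (st (v.drop i))), length_st, hlen]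
  have hterm (l : ℕ) (hl : l + 2 ≤ m + 2) : ofWord (st (v.drop (l + 2))) =
      (ofWord (etaWord 1 (m - l)) : SSym k) := by
    rw [st_of_pairwise_lt]
    · simp [hlen]
    · rw [hv, List.drop_take, add_comm l 2, ← List.drop_drop]
      exact hs.sublist ((List.take_sublist _ _).trans (List.drop_sublist _ _))
  rw [Finset.Nat.sum_antidiagonal_eq_sum_range_succ_mk, Finset.sum_range_succ]
  simp only [Nat.sub_self]
  rw [← hv, key, Finset.sum_range_succ', Finset.sum_range_succ']
  have e0 : (antipodeWord (st (v.take 0)) : SSym k) = 1 := by simp [st, antipodeWord.eq_1 []]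
  have e1 : (antipodeWord (st (v.take (0 + 1))) : SSym k) = - ofWord [1] := by
    obtain ⟨x, t, hx⟩ : ∃ x t, v = x :: t := List.exists_cons_of_length_eq_add_one hlen
    rw [hx, ← antipodeWord_singleton]
    simp [st, rank]
  have eE : (ofWord (etaWord 1 0) : SSym k) = 1 := ofWord_of isPerm_nil
  rw [e0, e1, eE, mul_one, one_mul, List.drop_zero]
  have : ∑ i ∈ Finset.range m, (antipodeWord (st (w.take (i + 2))) : SSym k) *
        ofWord (etaWord 1 (m - i)) = ∑ i ∈ Finset.range m,
        antipodeWord (st (v.take (i + 1 + 1))) * ofWord (st (v.drop (i + 1 + 1))) := by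
    refine Finset.sum_congr rfl fun i hi => ?_
    have hi := Finset.mem_range.mp hi
    rw [hterm i (by omega), hv, List.take_take, min_eq_left (by omega)]
  rw [this, neg_mul]
  simp only [zero_add]
  abel

/-- The antipode of a permutation that increases from its third letter on, in closed form: in the
recursion over its prefixes all right factors but two are identity permutations, and these are
inverted by the signed decreasing permutations. -/
theorem toWords_antipodeWord {w : List ℕ} (hw : w.Nodup) (hs : (w.drop 2).Pairwise (· < ·))
    (hn : 2 ≤ w.length) :
    toWords (antipodeWord (st w) : SSym k) =
      ∑ i ∈ Finset.Icc 2 w.length, (-1 : k) ^ (w.length + i + 1) •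
        ((word (st (w.take i)) - word [1] ⧢ word ((st ((w.take i).drop 1)).map (· + 1))) ⧢
          delta w.length (i + 1)) := by
  obtain ⟨m, hm⟩ := Nat.exists_eq_add_of_le' hn
  have h := eq_sum_of_convolution (fun p => (ofWord (etaWord 1 p) : SSym k))
    (fun q => (-1 : k) ^ q • ofWord (etaWord 1 q).reverse) sum_antidiagonal_identity_mul_reverse
    (fun p => antipodeWord (st (w.take (p + 2)))) m
  simp only [← hm, List.take_length] at h
  rw [h, map_sum, Finset.Nat.sum_antidiagonal_eq_sum_range_succ_mk, Finset.range_eq_Ico,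
    Nat.succ_eq_add_one, ← Finset.Ico_add_one_right_eq_Icc, show w.length + 1 = m + 1 + 2 by omega,
    show Finset.Ico 2 (m + 1 + 2) = Finset.Ico (0 + 2) (m + 1 + 2) from rfl,
    ← Finset.sum_Ico_add']
  refine Finset.sum_congr rfl fun i hi => ?_
  have hi := Finset.mem_Ico.mp hi
  have hn1 := hw.sublist (List.take_sublist (i + 2) w)
  have hn2 := hn1.sublist (List.drop_sublist 1 _)
  have hone : IsPerm [1] := by simp [IsPerm]
  simp only
  rw [sum_antipodeWord_mul_identity hw hs (by omega), mul_smul_comm, neg_mul, sub_mul, map_smul,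
    map_neg, map_sub, toWords_ofWord_mul_ofWord (isPerm_st hn1) (isPerm_reverse_etaWord _),
    toWords_ofWord_mul_mul hone (isPerm_st hn2) (isPerm_reverse_etaWord _),
    delta_of_le (by omega), map_sub, LinearMap.sub_apply, List.map_reverse, List.map_reverse,
    map_add_etaWord, map_add_etaWord, smul_neg, ← neg_smul]
  have e1 : 1 + (st (w.take (i + 2))).length = i + 2 + 1 := by
    simp; omega
  have e2 : 1 + ([1].length + (st ((w.take (i + 2)).drop 1)).length) = i + 2 + 1 := by
    simp; omega
  have e3 : m - i + (st (w.take (i + 2))).length = w.length := by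
    simp; omega
  have e4 : m - i + ([1].length + (st ((w.take (i + 2)).drop 1)).length) = w.length := by
    simp; omega
  rw [e1, e2, e3, e4]
  congr 1
  rw [show w.length + (i + 2) + 1 = m - i + 1 + 2 * (i + 2) by omega, pow_add, pow_mul, pow_succ]
  simp

/-! ### Prefixes of `σ_A` -/

/-- The standardization of the prefix of length `i` of `σ_A`, `A = {a, b}`, for `2 ≤ i`
(`st_take_sigmaWord`). -/
def sigmaPrefix (a b i : ℕ) : List ℕ :=
  if i ≤ b + 1 then [i, i - 1] ++ etaWord 1 (i - 2)
  else if i ≤ a then [i, b] ++ etaWord 1 (b - 1) ++ etaWord (b + 1) (i - 1)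
  else sigmaWord i a b

/-- The standardization of the prefix of length `i` of `σ_A` without its first letter, with `1`
added to every letter, for `2 ≤ i` (`map_add_one_st_tail`). It does not depend on `a`. -/
def sigmaTail (b i : ℕ) : List ℕ :=
  if i ≤ b + 1 then [i] ++ etaWord 2 (i - 1)
  else [b + 1] ++ etaWord 2 b ++ etaWord (b + 2) i

theorem take_sigmaWord_of_le {n a b i : ℕ} (hb : 1 ≤ b) (hi : 2 ≤ i)
    (h : i ≤ b + 1) : (sigmaWord n a b).take i = [a, b] ++ etaWord 1 (i - 2) := by
  have e : etaWord 1 (b - 1) = etaWord 1 (i - 2) ++ etaWord (i - 2 + 1) (b - 1) :=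
    (etaWord_append_etaWord (by omega) (by omega)).symm
  rw [sigmaWord, e]
  simp only [List.append_assoc]
  rw [← List.append_assoc, List.take_left']
  simp; omega

theorem take_sigmaWord_of_le_of_le {n a b i : ℕ} (hb : 1 ≤ b) (hba : b < a)
    (hi : b + 1 ≤ i) (h : i ≤ a) : (sigmaWord n a b).take i =
      [a, b] ++ etaWord 1 (b - 1) ++ etaWord (b + 1) (i - 1) := by
  have e : etaWord (b + 1) (a - 1) = etaWord (b + 1) (i - 1) ++ etaWord (i - 1 + 1) (a - 1) :=
    (etaWord_append_etaWord (by omega) (by omega)).symm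
  rw [sigmaWord, e]
  rw [← List.append_assoc, List.append_assoc _ _ (etaWord (a + 1) n), List.take_left']
  simp; omega

theorem take_sigmaWord_of_ge {n a b i : ℕ} (hb : 1 ≤ b) (hba : b < a)
    (hi : a ≤ i) (h : i ≤ n) : (sigmaWord n a b).take i = sigmaWord i a b := by
  have e : etaWord (a + 1) n = etaWord (a + 1) i ++ etaWord (i + 1) n :=
    (etaWord_append_etaWord (by omega) (by omega)).symm
  rw [sigmaWord, e, ← List.append_assoc, List.take_left', sigmaWord]
  simp; omega

theorem isPerm_cons_etaWord {m n : ℕ} (h1 : 1 ≤ m) (h2 : m ≤ n) :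
    IsPerm ([m] ++ etaWord 1 (m - 1) ++ etaWord (m + 1) n) := by
  refine (isPerm_etaWord n).perm ?_
  rw [← etaWord_append_etaWord (i := 1) (l := m - 1) (m := n) (by omega) (by omega),
    Nat.sub_add_cancel h1, etaWord_cons h2]
  exact List.perm_middle.symm

theorem st_take_sigmaWord {n a b i : ℕ} (hb : 1 ≤ b) (hba : b < a)
    (hi : 2 ≤ i) (h : i ≤ n) : st ((sigmaWord n a b).take i) = sigmaPrefix a b i := by
  rw [sigmaPrefix]
  split_ifs with h1 h2
  -- In each range, only the letters `a` and `b` can exceed the length `i` of the prefix.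
  · rw [take_sigmaWord_of_le hb hi h1]
    have e : ([a, b] ++ etaWord 1 (i - 2)).map
        (fun x => if x = a then i else if x = b then i - 1 else x) =
        [i, i - 1] ++ etaWord 1 (i - 2) := by
      have : (etaWord 1 (i - 2)).map (fun x => if x = a then i else if x = b then i - 1 else x) =
          (etaWord 1 (i - 2)).map id := List.map_congr_left fun x hx => by
        rw [mem_etaWord] at hx
        rw [if_neg (by omega), if_neg (by omega)]; rfl
      simp [this, hba.ne]
    rw [← e]
    refine st_eq_map ?_ ?_
    · simp only [List.mem_append, List.mem_cons, List.not_mem_nil, mem_etaWord, or_false]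
      intro x hx y hy
      split_ifs <;> omega
    · rw [e]
      have := isPerm_sigmaWord (n := i) (a := i) (b := i - 1) (by omega) (by omega) le_rfl
      rw [sigmaWord, etaWord_eq_nil (i := i - 1 + 1) (by omega),
        etaWord_eq_nil (i := i + 1) (by omega), Nat.sub_sub] at this
      simpa using this
  · rw [take_sigmaWord_of_le_of_le hb hba (by omega) h2]
    have e : ([a, b] ++ etaWord 1 (b - 1) ++ etaWord (b + 1) (i - 1)).map
        (fun x => if x = a then i else x) =
        [i, b] ++ etaWord 1 (b - 1) ++ etaWord (b + 1) (i - 1) := by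
      have (c d) (hd : d < a) : (etaWord c d).map (fun x => if x = a then i else x) =
          (etaWord c d).map id := List.map_congr_left fun x hx => by
        rw [mem_etaWord] at hx
        rw [if_neg (by omega)]; rfl
      simp [this (b + 1) (i - 1) (by omega), this 1 (b - 1) (by omega), hba.ne]
    rw [← e]
    refine st_eq_map ?_ ?_
    · simp only [List.mem_append, List.mem_cons, List.not_mem_nil, mem_etaWord, or_false]
      intro x hx y hy
      split_ifs <;> omega
    · rw [e]
      have := isPerm_sigmaWord (n := i) (a := i) (b := b) (by omega) (by omega) le_rfl
      rw [sigmaWord, etaWord_eq_nil (i := i + 1) (by omega)] at this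
      simpa using this
  · rw [take_sigmaWord_of_ge hb hba (by omega) h]
    exact (isPerm_sigmaWord hb hba (by omega)).st_eq

theorem map_add_one_st_tail {n a b i : ℕ} (hb : 1 ≤ b) (hba : b < a)
    (hi : 2 ≤ i) (h : i ≤ n) :
    (st (((sigmaWord n a b).take i).drop 1)).map (· + 1) = sigmaTail b i := by
  rw [sigmaTail]
  split_ifs with h1
  · rw [take_sigmaWord_of_le hb hi h1]
    have e : ([b] ++ etaWord 1 (i - 2)).map (fun x => if x = b then i - 1 else x) =
        [i - 1] ++ etaWord 1 (i - 2) := by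
      have : (etaWord 1 (i - 2)).map (fun x => if x = b then i - 1 else x) =
          (etaWord 1 (i - 2)).map id := List.map_congr_left fun x hx => by
        rw [mem_etaWord] at hx
        rw [if_neg (by omega)]; rfl
      simp [this]
    change (st ([b] ++ etaWord 1 (i - 2))).map (· + 1) = _
    rw [st_eq_map (f := fun x => if x = b then i - 1 else x), e]
    · rw [List.map_append, map_add_etaWord]
      simp; constructor
      · omega
      · congr 1; omega
    · simp only [List.mem_append, List.mem_cons, List.not_mem_nil, mem_etaWord, or_false]
      intro x hx y hy
      split_ifs <;> omega
    · rw [e]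
      have := isPerm_cons_etaWord (m := i - 1) (n := i - 1) (by omega) le_rfl
      rw [etaWord_eq_nil (i := i - 1 + 1) (by omega), Nat.sub_sub] at this
      simpa using this
  · have ht : st (((sigmaWord n a b).take i).drop 1) =
        [b] ++ etaWord 1 (b - 1) ++ etaWord (b + 1) (i - 1) := by
      rcases le_total i a with h2 | h2
      · rw [take_sigmaWord_of_le_of_le hb hba (by omega) h2]
        exact (isPerm_cons_etaWord hb (by omega)).st_eq
      · rw [take_sigmaWord_of_ge hb hba (by omega) h]
        -- The letter `a` has been removed, so the letters above it move down by one.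
        have e : ([b] ++ etaWord 1 (b - 1) ++ etaWord (b + 1) (a - 1) ++ etaWord (a + 1) i).map
            (fun x => if a < x then x - 1 else x) =
            [b] ++ etaWord 1 (b - 1) ++ etaWord (b + 1) (i - 1) := by
          have (c d) (hd : d < a) : (etaWord c d).map (fun x => if a < x then x - 1 else x) =
              (etaWord c d).map id := List.map_congr_left fun x hx => by
            rw [mem_etaWord] at hx
            rw [if_neg (by omega)]; rfl
          have h' : (etaWord (a + 1) i).map (fun x => if a < x then x - 1 else x) =
              etaWord (a - 1 + 1) (i - 1) := by
            have e' := map_add_etaWord 1 a (i - 1)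
            rw [show i - 1 + 1 = i by omega] at e'
            rw [← e', List.map_map, show a - 1 + 1 = a by omega]
            conv_rhs => rw [← List.map_id (etaWord a (i - 1))]
            refine List.map_congr_left fun x hx => ?_
            rw [mem_etaWord] at hx
            simp; omega
          rw [← etaWord_append_etaWord (i := b + 1) (l := a - 1) (m := i - 1) (by omega)
            (by omega), ← h']
          simp [this (b + 1) (a - 1) (by omega), this 1 (b - 1) (by omega), hba.le]
        change st ([b] ++ etaWord 1 (b - 1) ++ etaWord (b + 1) (a - 1) ++ etaWord (a + 1) i) = _
        rw [← e]
        refine st_eq_map ?_ ?_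
        · simp only [List.mem_append, List.mem_cons, List.not_mem_nil, mem_etaWord, or_false]
          intro x hx y hy
          split_ifs <;> omega
        · rw [e]
          exact isPerm_cons_etaWord hb (by omega)
    rw [ht, List.map_append, List.map_append, map_add_etaWord, map_add_etaWord]
    simp only [List.map_cons, List.map_nil]
    rw [show b - 1 + 1 = b by omega, show i - 1 + 1 = i by omega]

theorem pairwise_lt_drop_sigmaWord {a b : ℕ} (n : ℕ) (hba : b < a) :
    ((sigmaWord n a b).drop 2).Pairwise (· < ·) := by
  change (etaWord 1 (b - 1) ++ etaWord (b + 1) (a - 1) ++ etaWord (a + 1) n).Pairwise (· < ·)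
  simp only [List.pairwise_append, mem_etaWord, List.mem_append]
  refine ⟨⟨List.pairwise_lt_range', List.pairwise_lt_range', ?_⟩, List.pairwise_lt_range', ?_⟩ <;>
  · intros; omega

theorem toWords_antipode_sigma {n a b : ℕ} (hb : 1 ≤ b) (hba : b < a) (han : a ≤ n) :
    toWords (HopfAlgebra.antipode k (F (sigma n a b hb hba han) : SSym k)) =
      ∑ i ∈ Finset.Icc 2 n, (-1 : k) ^ (n + i + 1) •
        ((word (sigmaPrefix a b i) - word [1] ⧢ word (sigmaTail b i)) ⧢ delta n (i + 1)) := by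
  have hp := isPerm_sigmaWord hb hba han
  have hlen : (sigmaWord n a b).length = n := by
    simp [sigmaWord, etaWord]; omega
  have h := toWords_antipodeWord (k := k) hp.nodup (pairwise_lt_drop_sigmaWord n hba) (by omega)
  rw [hp.st_eq, hlen] at h
  change toWords (antipodeMap (F (sigma n a b hb hba han))) = _
  rw [antipodeMap, lift_F]
  refine h.trans (Finset.sum_congr rfl fun i hi => ?_)
  have hi := Finset.mem_Icc.mp hi
  rw [st_take_sigmaWord hb hba hi.1 hi.2, map_add_one_st_tail hb hba hi.1 hi.2]

/-- The part of `S(σ_A)` ending in `j`, separated according to where the last letter comes from: a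
prefix of `σ_A`, a tail, the letter `1`, or the decreasing word. -/
theorem antipodeStar_sigma {n a b : ℕ} (hb : 1 ≤ b) (hba : b < a) (han : a ≤ n) (j : ℕ) :
    antipodeStar k (sigma n a b hb hba han) j =
      (∑ i ∈ Finset.Icc 2 n, (-1 : k) ^ (n + i + 1) •
        (endStar j (word (sigmaPrefix a b i)) ⧢ delta n (i + 1))) +
      (∑ i ∈ Finset.Icc 2 n, (-1 : k) ^ (n + i) •
        (word [1] ⧢ endStar j (word (sigmaTail b i)) ⧢ delta n (i + 1))) +
      (∑ i ∈ Finset.Icc 2 n, (-1 : k) ^ (n + i) • if 1 = j then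
        word (sigmaTail b i) ⧢ delta n (i + 1) else 0) +
      (∑ i ∈ Finset.Icc 2 n, (-1 : k) ^ (n + i + 1) • if i + 1 = j then
        (word (sigmaPrefix a b i) - word [1] ⧢ word (sigmaTail b i)) ⧢ delta n (i + 2) else 0) := by
  rw [antipodeStar, toWords_antipode_sigma, map_sum, ← Finset.sum_add_distrib,
    ← Finset.sum_add_distrib, ← Finset.sum_add_distrib]
  refine Finset.sum_congr rfl fun i hi => ?_
  have hi := Finset.mem_Icc.mp hi
  have h1 : endStar j (word [1] : Words k) = if 1 = j then word [] else 0 :=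
    endStar_word_append_singleton j 1 []
  rw [map_smul, endStar_shuffle, map_sub, endStar_shuffle, endStar_delta _ (by omega), h1, pow_succ]
  simp only [map_add, map_sub, LinearMap.add_apply, LinearMap.sub_apply]
  split_ifs <;> simp [smul_sub, smul_add] <;> abel

/-! ### Contributions to the words with a given last letter -/

theorem sigmaPrefix_of_ge {a b i : ℕ} (hb : 1 ≤ b) (hba : b < a) (h : a ≤ i) :
    sigmaPrefix a b i = sigmaWord i a b := by
  have := st_take_sigmaWord (n := i) hb hba (by omega) le_rfl
  rw [take_sigmaWord_of_ge hb hba h le_rfl, (isPerm_sigmaWord hb hba h).st_eq] at this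
  exact this.symm

theorem endStar_sigmaPrefix_two {b : ℕ} (a j : ℕ) (hb : 1 ≤ b) :
    endStar j (word (sigmaPrefix a b 2) : Words k) = if 1 = j then word [2] else 0 := by
  rw [sigmaPrefix, if_pos (by omega)]
  exact endStar_word_append_singleton j 1 [2]

/-- The last letter of `sigmaPrefix a b i` is `i - 2`, `i - 1` or `i`, according to whether
`i ≤ b + 1`, `b + 2 ≤ i ≤ a` or `a < i`. -/
theorem endStar_sigmaPrefix {a b i : ℕ} (j : ℕ) (hb : 1 ≤ b) (hba : b < a) (hi : 3 ≤ i) :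
    endStar j (word (sigmaPrefix a b i) : Words k) =
      if i ≤ b + 1 then (if i = j + 2 then word ([i, i - 1] ++ etaWord 1 (i - 3)) else 0)
      else if i ≤ a then
        (if i = j + 1 then word ([i, b] ++ etaWord 1 (b - 1) ++ etaWord (b + 1) (i - 2)) else 0)
      else if i = j then word (sigmaPrefix a b (i - 1)) else 0 := by
  obtain ⟨d, rfl⟩ := Nat.exists_eq_add_of_le' hi
  split_ifs with h1 h2 h3 h4 h5
  · rw [sigmaPrefix, if_pos h1, show d + 3 - 2 = d + 1 by omega,
      etaWord_append_singleton (by omega), ← List.append_assoc, endStar_word_append_singleton,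
      if_pos (by omega)]; rfl
  · rw [sigmaPrefix, if_pos h1, show d + 3 - 2 = d + 1 by omega,
      etaWord_append_singleton (by omega), ← List.append_assoc, endStar_word_append_singleton,
      if_neg (by omega)]
  · rw [sigmaPrefix, if_neg h1, if_pos h3, show d + 3 - 1 = d + 1 + 1 by omega,
      etaWord_append_singleton (by omega), ← List.append_assoc, endStar_word_append_singleton,
      if_pos (by omega)]; rfl
  · rw [sigmaPrefix, if_neg h1, if_pos h3, show d + 3 - 1 = d + 1 + 1 by omega,
      etaWord_append_singleton (by omega), ← List.append_assoc, endStar_word_append_singleton,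
      if_neg (by omega)]
  all_goals
    rw [sigmaPrefix, if_neg h1, if_neg h3, sigmaWord, etaWord_append_singleton (by omega),
      ← List.append_assoc, endStar_word_append_singleton]
  · rw [if_pos h5, sigmaPrefix_of_ge hb hba (by omega)]; rfl
  · rw [if_neg h5]

theorem endStar_sigmaTail_two {b : ℕ} (j : ℕ) (hb : 1 ≤ b) :
    endStar j (word (sigmaTail b 2) : Words k) = if 2 = j then word [] else 0 := by
  rw [sigmaTail, if_pos (by omega)]
  exact endStar_word_append_singleton j 2 []

theorem sigmaTail_of_ge {b i : ℕ} (h : b + 1 ≤ i) :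
    sigmaTail b i = [b + 1] ++ etaWord 2 b ++ etaWord (b + 2) i := by
  rw [sigmaTail]
  split_ifs with h1
  -- The two descriptions agree for `i = b + 1`, where `η_{b+2,b+1}` is empty.
  · obtain rfl : i = b + 1 := by omega
    rw [etaWord_eq_nil (i := b + 2) (by omega)]; simp
  · rfl

/-- The last letter of `sigmaTail b i` is `i - 1` if `i ≤ b + 1`, and `i` otherwise. -/
theorem endStar_sigmaTail {b i : ℕ} (j : ℕ) (hi : 3 ≤ i) :
    endStar j (word (sigmaTail b i) : Words k) =
      if i ≤ b + 1 then (if i = j + 1 then word ([i] ++ etaWord 2 (i - 2)) else 0)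
      else if i = j then word (sigmaTail b (i - 1)) else 0 := by
  obtain ⟨d, rfl⟩ := Nat.exists_eq_add_of_le' hi
  split_ifs with h1 h2 h3
  · rw [sigmaTail, if_pos h1, show d + 3 - 1 = d + 1 + 1 by omega,
      etaWord_append_singleton (by omega), ← List.append_assoc, endStar_word_append_singleton,
      if_pos (by omega)]; rfl
  · rw [sigmaTail, if_pos h1, show d + 3 - 1 = d + 1 + 1 by omega,
      etaWord_append_singleton (by omega), ← List.append_assoc, endStar_word_append_singleton,
      if_neg (by omega)]
  all_goals
    rw [sigmaTail, if_neg h1, etaWord_append_singleton (by omega),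
      ← List.append_assoc, endStar_word_append_singleton]
  · rw [if_pos h3, sigmaTail_of_ge (by omega)]; rfl
  · rw [if_neg h3]

/-- The contribution to `S(σ_A)_j^*` of the words whose last letter `j` comes from a prefix of
`σ_A`. For `j ≥ 2` at most one summand is nonzero. -/
def prefixSum (k : Type*) [CommRing k] (n a b j : ℕ) : Words k :=
  ∑ i ∈ Finset.Icc 2 n, (-1 : k) ^ (n + i + 1) •
    (endStar j (word (sigmaPrefix a b i)) ⧢ delta n (i + 1))

/-- The contribution to `S(σ_A)_j^*` of the words whose last letter `j` comes from the tail of a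
prefix of `σ_A`. For `j ≠ 2` at most one summand is nonzero. -/
def tailSum (k : Type*) [CommRing k] (n b j : ℕ) : Words k :=
  ∑ i ∈ Finset.Icc 2 n, (-1 : k) ^ (n + i) •
    (word [1] ⧢ endStar j (word (sigmaTail b i)) ⧢ delta n (i + 1))

theorem prefixSum_eq_of_two_le {n a b j : ℕ} (hb : 1 ≤ b) (hn : 2 ≤ n) (hj : 2 ≤ j) :
    prefixSum k n a b j = ∑ i ∈ Finset.Icc 3 n, (-1 : k) ^ (n + i + 1) •
      (endStar j (word (sigmaPrefix a b i)) ⧢ delta n (i + 1)) := by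
  rw [prefixSum, sum_Icc_eq_add_sum _ hn, endStar_sigmaPrefix_two _ _ hb, if_neg (by omega)]
  simp

theorem prefixSum_of_lt {n a b j : ℕ} (hba : b < a) (han : a ≤ n)
    (hj : 2 ≤ j) (hjb : j < b) :
    prefixSum k n a b j = (-1 : k) ^ (n + j + 1) •
      (word ([j + 2, j + 1] ++ etaWord 1 (j - 1)) ⧢ delta n (j + 3)) := by
  rw [prefixSum_eq_of_two_le (by omega) (by omega) hj, Finset.sum_eq_single (j + 2)]
  · rw [endStar_sigmaPrefix _ (by omega) hba (by omega), if_pos (by omega), if_pos rfl,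
      show n + (j + 2) + 1 = n + j + 1 + 2 by omega, pow_add, show j + 2 - 3 = j - 1 by omega]
    simp
  · intro i hi hij
    have hi := Finset.mem_Icc.mp hi
    rw [endStar_sigmaPrefix _ (by omega) hba hi.1]
    split_ifs <;> first | omega | simp
  · simp; omega

theorem prefixSum_eq_zero {n a b j : ℕ} (hb : 1 ≤ b) (hba : b < a) (han : a ≤ n)
    (hj : 2 ≤ j) (hjb : j = b ∨ j = a) :
    prefixSum k n a b j = 0 := by
  rw [prefixSum_eq_of_two_le (by omega) (by omega) hj]
  refine Finset.sum_eq_zero fun i hi => ?_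
  have hi := Finset.mem_Icc.mp hi
  rw [endStar_sigmaPrefix _ hb hba hi.1]
  split_ifs <;> first | omega | simp

theorem prefixSum_of_lt_of_lt {n a b j : ℕ} (hb : 1 ≤ b) (han : a ≤ n)
    (hbj : b < j) (hja : j < a) :
    prefixSum k n a b j = (-1 : k) ^ (n + j) •
      (word ([j + 1, b] ++ etaWord 1 (b - 1) ++ etaWord (b + 1) (j - 1)) ⧢ delta n (j + 2)) := by
  rw [prefixSum_eq_of_two_le (by omega) (by omega) (by omega),
    Finset.sum_eq_single (j + 1)]
  · rw [endStar_sigmaPrefix _ (by omega) (by omega) (by omega), if_neg (by omega),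
      if_pos (by omega), if_pos rfl,
      show n + (j + 1) + 1 = n + j + 2 by omega, pow_add, show j + 1 - 2 = j - 1 by omega]
    simp
  · intro i hi hij
    have hi := Finset.mem_Icc.mp hi
    rw [endStar_sigmaPrefix _ (by omega) (by omega) hi.1]
    split_ifs <;> first | omega | simp
  · simp; omega

theorem prefixSum_of_gt {n a b j : ℕ} (hb : 1 ≤ b) (hba : b < a)
    (haj : a < j) (hjn : j ≤ n) :
    prefixSum k n a b j = (-1 : k) ^ (n + j + 1) •
      (word (sigmaPrefix a b (j - 1)) ⧢ delta n (j + 1)) := by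
  rw [prefixSum_eq_of_two_le (by omega) (by omega) (by omega),
    Finset.sum_eq_single j]
  · rw [endStar_sigmaPrefix _ (by omega) (by omega) (by omega), if_neg (by omega),
      if_neg (by omega), if_pos rfl]
  · intro i hi hij
    have hi := Finset.mem_Icc.mp hi
    rw [endStar_sigmaPrefix _ (by omega) (by omega) hi.1]
    split_ifs <;> first | omega | simp
  · simp; omega

theorem prefixSum_one {n a b : ℕ} (hb : 2 ≤ b) (hba : b < a) (han : a ≤ n) :
    prefixSum k n a b 1 = (-1 : k) ^ (n + 1) • (word [2] ⧢ delta n 3) +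
      (-1 : k) ^ n • (word [3, 2] ⧢ delta n 4) := by
  rw [prefixSum, sum_Icc_eq_add_sum _ (by omega), sum_Icc_eq_add_sum _ (by omega),
    Finset.sum_eq_zero, endStar_sigmaPrefix_two _ _ (by omega),
    endStar_sigmaPrefix _ (by omega) hba (by omega), if_pos rfl, if_pos (by omega), if_pos rfl]
  · simp [pow_succ, etaWord]
  · intro i hi
    have hi := Finset.mem_Icc.mp hi
    rw [endStar_sigmaPrefix _ (by omega) hba (by omega)]
    split_ifs <;> first | omega | simp

theorem prefixSum_one_of_eq_one {n a : ℕ} (hba : 1 < a) (han : a ≤ n) :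
    prefixSum k n a 1 1 = (-1 : k) ^ (n + 1) • (word [2] ⧢ delta n 3) := by
  rw [prefixSum, sum_Icc_eq_add_sum _ (by omega),
    Finset.sum_eq_zero, endStar_sigmaPrefix_two _ _ (by omega), if_pos rfl]
  · simp [pow_succ]
  · intro i hi
    have hi := Finset.mem_Icc.mp hi
    rw [endStar_sigmaPrefix _ (by omega) hba (by omega)]
    split_ifs <;> first | omega | simp

theorem tailSum_eq_of_ne_two {n b j : ℕ} (hb : 1 ≤ b) (hn : 2 ≤ n) (hj : j ≠ 2) :
    tailSum k n b j = ∑ i ∈ Finset.Icc 3 n, (-1 : k) ^ (n + i) •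
      (word [1] ⧢ endStar j (word (sigmaTail b i)) ⧢ delta n (i + 1)) := by
  rw [tailSum, sum_Icc_eq_add_sum _ hn, endStar_sigmaTail_two _ hb, if_neg (by omega)]
  simp

theorem tailSum_eq_zero {n b j : ℕ} (hb : 1 ≤ b) (hn : 2 ≤ n) (hj : j = 1 ∨ (3 ≤ j ∧ j = b + 1)) :
    tailSum k n b j = 0 := by
  rw [tailSum_eq_of_ne_two hb hn (by omega)]
  refine Finset.sum_eq_zero fun i hi => ?_
  have hi := Finset.mem_Icc.mp hi
  rw [endStar_sigmaTail _ hi.1]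
  split_ifs <;> first | omega | simp

theorem tailSum_of_le {n b j : ℕ} (hbn : b < n) (hj : 3 ≤ j) (hjb : j ≤ b) :
    tailSum k n b j = (-1 : k) ^ (n + j + 1) •
      (word [1] ⧢ word [j + 1] ⬝ eta 2 (j - 1) ⧢ delta n (j + 2)) := by
  rw [tailSum_eq_of_ne_two (by omega) (by omega) (by omega), Finset.sum_eq_single (j + 1),
    eta_of_le (by omega), concat_word]
  · rw [endStar_sigmaTail _ (by omega), if_pos (by omega), if_pos rfl]
    rfl
  · intro i hi hij
    have hi := Finset.mem_Icc.mp hi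
    rw [endStar_sigmaTail _ hi.1]
    split_ifs <;> first | omega | simp
  · simp; omega

theorem tailSum_of_ge {n b j : ℕ} (hb : 1 ≤ b) (hjb : b + 2 ≤ j) (hjn : j ≤ n) :
    tailSum k n b j = (-1 : k) ^ (n + j) •
      (word [1] ⧢ word (sigmaTail b (j - 1)) ⧢ delta n (j + 1)) := by
  rw [tailSum_eq_of_ne_two (by omega) (by omega) (by omega), Finset.sum_eq_single j]
  · rw [endStar_sigmaTail _ (by omega), if_neg (by omega), if_pos rfl]
  · intro i hi hij
    have hi := Finset.mem_Icc.mp hi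
    rw [endStar_sigmaTail _ hi.1]
    split_ifs <;> first | omega | simp
  · simp; omega

theorem tailSum_two {n b : ℕ} (hb : 2 ≤ b) (hbn : b < n) :
    tailSum k n b 2 = (-1 : k) ^ (n + 1) • (word [1] ⧢ (word [3] ⧢ delta n 5) ⬝ word [4]) := by
  have e := word_append_singleton_shuffle_delta (k := k) [] 3 (n := n) (i := 4) (by omega)
  rw [shuffle_nil_left, ← delta_eq_concat (by omega)] at e
  have h : tailSum k n b 2 = (-1 : k) ^ n • (word [1] ⧢ delta n 3) +
      (-1 : k) ^ (n + 1) • (word [1] ⧢ word [3] ⧢ delta n 4) := by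
    rw [tailSum, sum_Icc_eq_add_sum _ (by omega), sum_Icc_eq_add_sum _ (by omega),
      Finset.sum_eq_zero, endStar_sigmaTail_two _ (by omega),
      endStar_sigmaTail _ (by omega), if_pos rfl, if_pos (by omega), if_pos rfl]
    · simp [pow_succ, etaWord, shuffle_nil_right]
    · intro i hi
      have hi := Finset.mem_Icc.mp hi
      rw [endStar_sigmaTail _ (by omega)]
      split_ifs <;> first | omega | simp
  rw [h, shuffle_assoc, show ([3] : List ℕ) = [] ++ [3] from rfl, e, neg_one_pow_succ, map_add]
  module

theorem tailSum_one_two {n : ℕ} (hn : 2 ≤ n) :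
    tailSum k n 1 2 = (-1 : k) ^ n • (word [1] ⧢ delta n 3) := by
  rw [tailSum, sum_Icc_eq_add_sum _ (by omega),
    Finset.sum_eq_zero, endStar_sigmaTail_two _ (by omega), if_pos rfl]
  · simp [shuffle_nil_right, pow_add]
  · intro i hi
    have hi := Finset.mem_Icc.mp hi
    rw [endStar_sigmaTail _ (by omega)]
    split_ifs <;> first | omega | simp

theorem antipodeStar_sigma_one {n a b : ℕ} (hb : 1 ≤ b) (hba : b < a) (han : a ≤ n) :
    antipodeStar k (sigma n a b hb hba han) 1 = prefixSum k n a b 1 +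
      ∑ i ∈ Finset.Icc 2 n, (-1 : k) ^ (n + i) • (word (sigmaTail b i) ⧢ delta n (i + 1)) := by
  rw [antipodeStar_sigma, ← prefixSum, ← tailSum, tailSum_eq_zero hb (by omega) (by simp), add_zero]
  simp only [if_true]
  rw [Finset.sum_eq_zero (s := Finset.Icc 2 n) (f := fun i => (-1 : k) ^ (n + i + 1) • ite _ _ _),
    add_zero]
  intro i hi
  have hi := Finset.mem_Icc.mp hi
  rw [if_neg (by omega), smul_zero]

theorem antipodeStar_sigma_two {n a b : ℕ} (hb : 1 ≤ b) (hba : b < a) (han : a ≤ n) :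
    antipodeStar k (sigma n a b hb hba han) 2 = prefixSum k n a b 2 + tailSum k n b 2 := by
  rw [antipodeStar_sigma, ← prefixSum, ← tailSum, Finset.sum_eq_zero, Finset.sum_eq_zero]
  · simp
  · intro i hi
    have hi := Finset.mem_Icc.mp hi
    rw [if_neg (by omega), smul_zero]
  · simp

theorem antipodeStar_sigma_of_three_le {n a b j : ℕ} (hb : 1 ≤ b) (hba : b < a) (han : a ≤ n)
    (hj : 3 ≤ j) (hjn : j ≤ n) :
    antipodeStar k (sigma n a b hb hba han) j = prefixSum k n a b j + tailSum k n b j +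
      (-1 : k) ^ (n + j) •
        ((word (sigmaPrefix a b (j - 1)) - word [1] ⧢ word (sigmaTail b (j - 1))) ⧢
          delta n (j + 1)) := by
  rw [antipodeStar_sigma, ← prefixSum, ← tailSum, Finset.sum_eq_zero,
    Finset.sum_eq_single (j - 1), add_zero, if_pos (by omega)]
  · rw [show n + (j - 1) + 1 = n + j by omega, show j - 1 + 2 = j + 1 by omega]
  · intro i hi hij
    rw [if_neg (by omega), smul_zero]
  · simp; omega
  · intro i hi
    rw [if_neg (by omega), smul_zero]

theorem sum_sigmaTail_of_eq_one {n : ℕ} (hn : 2 ≤ n) :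
    ∑ i ∈ Finset.Icc 2 n, (-1 : k) ^ (n + i) •
      (word (sigmaTail 1 i) ⧢ (delta n (i + 1) : Words k)) = (-1 : k) ^ n • delta n 2 := by
  rw [Finset.sum_congr rfl (g := fun i => (-1 : k) ^ (n + i) •
    (word ([] ++ [2] ++ etaWord (2 + 1) i) ⧢ (delta n (i + 1) : Words k))) (fun i hi => by
      rw [sigmaTail_of_ge (Finset.mem_Icc.mp hi).1]; simp [etaWord]),
    sum_eta_shuffle_delta _ _ hn, shuffle_nil_left, ← delta_eq_concat hn]
  simp [pow_add]

/-- The tails with `i > b` have the common form `u b η_{b+2,i}`, so their contributions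
telescope. -/
theorem sum_sigmaTail {n b : ℕ} (hb : 2 ≤ b) (hbn : b < n) :
    ∑ i ∈ Finset.Icc 2 n, (-1 : k) ^ (n + i) •
      (word (sigmaTail b i) ⧢ (delta n (i + 1) : Words k)) =
    ∑ i ∈ Finset.Icc 2 b, (-1 : k) ^ (n + i) •
      (word [i] ⬝ eta 2 (i - 1) ⧢ delta n (i + 1)) +
    (-1 : k) ^ (n + b + 1) • ((word [b + 1] ⬝ eta 2 (b - 1) ⧢ delta n (b + 2)) ⬝ word [b]) := by
  have e := sum_eta_shuffle_delta (k := k) ([b + 1] ++ etaWord 2 (b - 1)) b (l := b + 1) hbn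
  rw [← Finset.Ico_add_one_right_eq_Icc, ← Finset.sum_Ico_consecutive _ (n := b + 1) (by omega)
    (by omega), Finset.Ico_add_one_right_eq_Icc, Finset.Ico_add_one_right_eq_Icc,
    eta_of_le (by omega), concat_word, add_assoc n, ← e]
  congr 1
  · refine Finset.sum_congr rfl fun i hi => ?_
    have hi := Finset.mem_Icc.mp hi
    rw [sigmaTail, if_pos (by omega), eta_of_le (by omega), concat_word]
  · refine Finset.sum_congr rfl fun i hi => ?_
    have hi := Finset.mem_Icc.mp hi
    obtain ⟨d, rfl⟩ := Nat.exists_eq_add_of_le' hb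
    rw [sigmaTail_of_ge hi.1, etaWord_append_singleton (by omega)]
    simp

theorem word_sigmaPrefix_pred (a : ℕ) {b j : ℕ} (hj : 3 ≤ j) (hjb : j ≤ b + 2) :
    (word (sigmaPrefix a b (j - 1)) : Words k) = delta (j - 1) (j - 2) ⬝ eta 1 (j - 3) := by
  obtain ⟨d, rfl⟩ := Nat.exists_eq_add_of_le' hj
  rw [sigmaPrefix, if_pos (by omega), show d + 3 - 1 = d + 1 + 1 by omega,
    show d + 3 - 2 = d + 1 by omega, delta_succ_self, eta_of_le (by omega), concat_word]
  rfl

theorem word_sigmaTail_pred {b j : ℕ} (hj : 3 ≤ j) (hjb : j ≤ b + 2) :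
    (word (sigmaTail b (j - 1)) : Words k) = word [j - 1] ⬝ eta 2 (j - 2) := by
  rw [sigmaTail, if_pos (by omega), eta_of_le (by omega), concat_word, Nat.sub_sub]

theorem word_sigmaPrefix_pred_of_lt_of_le {a b j : ℕ} (hjb : b + 2 ≤ j) (hja : j ≤ a) (hb : 1 ≤ b) :
    (word (sigmaPrefix a b (j - 1)) : Words k) =
      word [j - 1, b] ⬝ eta 1 (b - 1) ⬝ eta (b + 1) (j - 2) := by
  rw [eta_of_le (by omega), eta_of_le (by omega), concat_word, concat_word, sigmaPrefix]
  split_ifs with h1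
  · obtain rfl : j = b + 2 := by omega
    rw [etaWord_eq_nil (i := b + 1) (by omega)]
    simp
  · rw [Nat.sub_sub]
  · omega

/-! ### The formulas for the range of each last letter -/

theorem antipodeStar_one_of_eq_one {n a b : ℕ} (hb : 1 ≤ b) (hba : b < a) (han : a ≤ n)
    (h : b = 1) :
    antipodeStar k (sigma n a b hb hba han) 1 =
      (-1 : k) ^ (n + 1) • ((word [2] ⧢ delta n 4) ⬝ word [3]) := by
  subst h
  have e := word_append_singleton_shuffle_delta (k := k) [] 2 (n := n) (i := 3) (by omega)
  rw [shuffle_nil_left, ← delta_eq_concat (by omega)] at e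
  rw [antipodeStar_sigma_one, prefixSum_one_of_eq_one hba han, sum_sigmaTail_of_eq_one (by omega),
    show ([2] : List ℕ) = [] ++ [2] from rfl, e, neg_one_pow_succ]
  module

theorem antipodeStar_one_of_eq_two {n a b : ℕ} (hb : 1 ≤ b) (hba : b < a) (han : a ≤ n)
    (h : b = 2) :
    antipodeStar k (sigma n a b hb hba han) 1 =
      (-1 : k) ^ n • ((word [3, 2] ⧢ delta n 5) ⬝ word [4]) := by
  subst h
  have e := word_append_singleton_shuffle_delta (k := k) [3] 2 (n := n) (i := 4) (by omega)
  have e2 : (eta 2 1 : Words k) = word [] := eta_of_le (by omega)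
  rw [antipodeStar_sigma_one, prefixSum_one le_rfl hba han, sum_sigmaTail le_rfl (by omega),
    Finset.Icc_self, Finset.sum_singleton, show ([3, 2] : List ℕ) = [3] ++ [2] from rfl, e, e2,
    concat_word, concat_word]
  simp only [neg_one_pow_succ, pow_add, List.append_nil]
  module

theorem antipodeStar_one_of_three_le {n a b : ℕ} (hb : 1 ≤ b) (hba : b < a) (han : a ≤ n)
    (h : 3 ≤ b) :
    antipodeStar k (sigma n a b hb hba han) 1 =
      (-1 : k) ^ (n + b + 1) • ((word [b + 1] ⬝ eta 2 (b - 1) ⧢ delta n (b + 2)) ⬝ word [b]) +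
      ∑ i ∈ Finset.Icc 4 b,
        (-1 : k) ^ (n + i) • (word [i] ⬝ eta 2 (i - 1) ⧢ delta n (i + 1)) := by
  have e2 : (eta 2 1 : Words k) = word [] := eta_of_le (by omega)
  have e3 : (eta 2 2 : Words k) = word [2] := eta_of_le (by omega)
  rw [antipodeStar_sigma_one, prefixSum_one (by omega) hba han, sum_sigmaTail (by omega) (by omega),
    sum_Icc_eq_add_sum _ (by omega), sum_Icc_eq_add_sum _ (by omega)]
  simp only [Nat.add_one_sub_one, Nat.reduceAdd, e2, e3, concat_word,
    List.append_nil, List.singleton_append, neg_one_pow_succ]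
  module

theorem antipodeStar_two_of_eq_one_of_eq_two {n a b : ℕ} (hb : 1 ≤ b) (hba : b < a) (han : a ≤ n)
    (h : b = 1) (ha : a = 2) :
    antipodeStar k (sigma n a b hb hba han) 2 = (-1 : k) ^ n • (word [1] ⧢ delta n 3) := by
  subst h
  rw [antipodeStar_sigma_two, tailSum_one_two (by omega),
    prefixSum_eq_zero le_rfl hba han le_rfl (Or.inr ha.symm), zero_add]

theorem antipodeStar_two_of_eq_one_of_three_le {n a b : ℕ} (hb : 1 ≤ b) (hba : b < a)
    (han : a ≤ n) (h : b = 1) (ha : 3 ≤ a) :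
    antipodeStar k (sigma n a b hb hba han) 2 =
      (-1 : k) ^ n • ((word [1] ⧢ delta n 3) + (word [3, 1] ⧢ delta n 4)) := by
  subst h
  rw [antipodeStar_sigma_two, tailSum_one_two (by omega),
    prefixSum_of_lt_of_lt le_rfl han (by omega) (by omega), add_comm, smul_add]
  simp [pow_add, etaWord]

theorem antipodeStar_two_of_eq_two {n a b : ℕ} (hb : 1 ≤ b) (hba : b < a) (han : a ≤ n)
    (h : b = 2) :
    antipodeStar k (sigma n a b hb hba han) 2 =
      (-1 : k) ^ (n + 1) • (word [1] ⧢ (word [3] ⧢ delta n 5) ⬝ word [4]) := by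
  rw [antipodeStar_sigma_two, prefixSum_eq_zero hb hba han le_rfl (Or.inl h.symm), zero_add,
    tailSum_two (by omega) (by omega)]

theorem antipodeStar_two_of_three_le {n a b : ℕ} (hb : 1 ≤ b) (hba : b < a) (han : a ≤ n)
    (h : 3 ≤ b) :
    antipodeStar k (sigma n a b hb hba han) 2 =
      (-1 : k) ^ (n + 1) • ((word [1] ⧢ (word [3] ⧢ delta n 5) ⬝ word [4]) +
        (word [4, 3, 1] ⧢ delta n 5)) := by
  have e : [2 + 2, 2 + 1] ++ etaWord 1 (2 - 1) = [4, 3, 1] := rfl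
  rw [antipodeStar_sigma_two, prefixSum_of_lt hba han le_rfl h, tailSum_two (by omega)
    (by omega), e, smul_add, add_comm]
  simp [pow_add]

/-- For `3 ≤ j ≤ b + 1` the contribution of the decreasing word is the element `P_j`, up to sign. -/
theorem antipodeStar_sigma_of_le {n a b j : ℕ} (hb : 1 ≤ b) (hba : b < a) (han : a ≤ n)
    (hj : 3 ≤ j) (hjb : j ≤ b + 1) :
    antipodeStar k (sigma n a b hb hba han) j = prefixSum k n a b j + tailSum k n b j +
      (-1 : k) ^ (n + j + 1) •
        (((word [1] ⧢ word [j - 1] ⬝ eta 2 (j - 2)) - delta (j - 1) (j - 2) ⬝ eta 1 (j - 3)) ⧢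
          delta n (j + 1)) := by
  rw [antipodeStar_sigma_of_three_le hb hba han hj (by omega),
    word_sigmaPrefix_pred a hj (by omega), word_sigmaTail_pred hj (by omega), neg_one_pow_succ,
    ← neg_sub (_ ⧢ _), map_neg, LinearMap.neg_apply, smul_neg, neg_smul]

theorem antipodeStar_of_lt {n a b j : ℕ} (hb : 1 ≤ b) (hba : b < a) (han : a ≤ n)
    (hj : 3 ≤ j) (hjb : j ≤ b - 1) :
    antipodeStar k (sigma n a b hb hba han) j = (-1 : k) ^ (n + j + 1) •
        (((word [1] ⧢ word [j - 1] ⬝ eta 2 (j - 2)) - delta (j - 1) (j - 2) ⬝ eta 1 (j - 3)) ⧢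
            delta n (j + 1) +
          (word [1] ⧢ word [j + 1] ⬝ eta 2 (j - 1) ⧢ delta n (j + 2)) +
          (delta (j + 2) (j + 1) ⬝ eta 1 (j - 1) ⧢ delta n (j + 3))) := by
  rw [antipodeStar_sigma_of_le hb hba han hj (by omega), tailSum_of_le (by omega) hj (by omega),
    prefixSum_of_lt hba han (by omega) (by omega), delta_succ_self, eta_of_le (i := 1) (l := j - 1)
    (by omega), concat_word (k := k) [j + 1 + 1, j + 1]]
  module

theorem antipodeStar_of_eq {n a b j : ℕ} (hb : 1 ≤ b) (hba : b < a) (han : a ≤ n)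
    (hj : 3 ≤ j) (hjb : j = b) :
    antipodeStar k (sigma n a b hb hba han) j = (-1 : k) ^ (n + j + 1) •
        (((word [1] ⧢ word [j - 1] ⬝ eta 2 (j - 2)) - delta (j - 1) (j - 2) ⬝ eta 1 (j - 3)) ⧢
            delta n (j + 1) +
          (word [1] ⧢ word [j + 1] ⬝ eta 2 (j - 1) ⧢ delta n (j + 2))) := by
  rw [antipodeStar_sigma_of_le hb hba han hj (by omega), tailSum_of_le (by omega) hj (by omega),
    prefixSum_eq_zero hb hba han (by omega) (Or.inl hjb)]
  module

theorem antipodeStar_of_eq_add_one_of_eq {n a b j : ℕ} (hb : 1 ≤ b) (hba : b < a) (han : a ≤ n)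
    (hj : 3 ≤ j) (hjb : j = b + 1) (ha : a = b + 1) :
    antipodeStar k (sigma n a b hb hba han) j = (-1 : k) ^ (n + j + 1) •
        (((word [1] ⧢ word [j - 1] ⬝ eta 2 (j - 2)) - delta (j - 1) (j - 2) ⬝ eta 1 (j - 3)) ⧢
            delta n (j + 1)) := by
  rw [antipodeStar_sigma_of_le hb hba han hj (by omega), tailSum_eq_zero hb (by omega)
    (Or.inr ⟨hj, hjb⟩), prefixSum_eq_zero hb hba han (by omega) (Or.inr (hjb.trans ha.symm)),
    add_zero, zero_add]

theorem antipodeStar_of_eq_add_one_of_le {n a b j : ℕ} (hb : 1 ≤ b) (hba : b < a) (han : a ≤ n)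
    (hj : 3 ≤ j) (hjb : j = b + 1) (ha : b + 2 ≤ a) :
    antipodeStar k (sigma n a b hb hba han) j = (-1 : k) ^ (n + j + 1) •
        (((word [1] ⧢ word [j - 1] ⬝ eta 2 (j - 2)) - delta (j - 1) (j - 2) ⬝ eta 1 (j - 3)) ⧢
            delta n (j + 1) -
          (word [j + 1, j - 1] ⬝ eta 1 (j - 2) ⧢ delta n (j + 2))) := by
  have e : [j + 1, b] ++ etaWord 1 (b - 1) ++ etaWord (b + 1) (j - 1) =
      [j + 1, j - 1] ++ etaWord 1 (j - 2) := by
    subst hjb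
    rw [etaWord_eq_nil (i := b + 1) (by omega), List.append_nil]; rfl
  rw [antipodeStar_sigma_of_le hb hba han hj (by omega), tailSum_eq_zero hb (by omega)
    (Or.inr ⟨hj, hjb⟩), prefixSum_of_lt_of_lt hb han (by omega) (by omega), e,
    eta_of_le (i := 1) (l := j - 2) (by omega), concat_word (k := k) [j + 1, j - 1],
    neg_one_pow_succ]
  module

theorem antipodeStar_of_lt_of_lt {n a b j : ℕ} (hb : 1 ≤ b) (hba : b < a) (han : a ≤ n)
    (hjb : b + 2 ≤ j) (hjn : j ≤ n) (hja : j ≤ a - 1) :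
    antipodeStar k (sigma n a b hb hba han) j = (-1 : k) ^ (n + j) •
        ((word [j - 1, b] ⬝ eta 1 (b - 1) ⬝ eta (b + 1) (j - 2) ⧢ delta n (j + 1)) +
          (word [j + 1, b] ⬝ eta 1 (b - 1) ⬝ eta (b + 1) (j - 1) ⧢ delta n (j + 2))) := by
  rw [antipodeStar_sigma_of_three_le hb hba han (by omega) hjn, tailSum_of_ge hb hjb hjn,
    prefixSum_of_lt_of_lt hb han (by omega) (by omega),
    word_sigmaPrefix_pred_of_lt_of_le hjb (by omega) hb, eta_of_le (i := b + 1) (l := j - 1)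
    (by omega), eta_of_le (i := 1) (l := b - 1) (by omega), concat_word (k := k) [j + 1, b],
    concat_word (k := k) (_ ++ _), map_sub, LinearMap.sub_apply]
  module

theorem antipodeStar_of_eq_right {n a b j : ℕ} (hb : 1 ≤ b) (hba : b < a) (han : a ≤ n)
    (hjb : b + 2 ≤ j) (hjn : j ≤ n) (hja : j = a) :
    antipodeStar k (sigma n a b hb hba han) j = (-1 : k) ^ (n + j) •
        (word [j - 1, b] ⬝ eta 1 (b - 1) ⬝ eta (b + 1) (j - 2) ⧢ delta n (j + 1)) := by
  rw [antipodeStar_sigma_of_three_le hb hba han (by omega) hjn, tailSum_of_ge hb hjb hjn,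
    prefixSum_eq_zero hb hba han (by omega) (Or.inr hja),
    word_sigmaPrefix_pred_of_lt_of_le hjb hja.le hb, map_sub, LinearMap.sub_apply]
  module

theorem antipodeStar_of_gt {n a b j : ℕ} (hb : 1 ≤ b) (hba : b < a) (han : a ≤ n)
    (hjb : b + 2 ≤ j) (hjn : j ≤ n) (hja : a + 1 ≤ j) :
    antipodeStar k (sigma n a b hb hba han) j = 0 := by
  -- The prefix and tail sums cancel against the two halves of the term with the decreasing word.
  rw [antipodeStar_sigma_of_three_le hb hba han (by omega) hjn, tailSum_of_ge hb hjb hjn,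
    prefixSum_of_gt hb hba hja hjn, map_sub, LinearMap.sub_apply, neg_one_pow_succ]
  module

theorem antipodeStar_sigma_congr {n a a' b j : ℕ} (hb : 1 ≤ b) (hba : b < a) (han : a ≤ n)
    (hba' : b < a') (han' : a' ≤ n) (hj : 1 ≤ j) (hjb : j ≤ b) :
    antipodeStar k (sigma n a b hb hba han) j = antipodeStar k (sigma n a' b hb hba' han') j := by
  obtain rfl | rfl | hj3 : j = 1 ∨ j = 2 ∨ 3 ≤ j := by omega
  · obtain h | h | h : b = 1 ∨ b = 2 ∨ 3 ≤ b := by omega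
    · simp only [antipodeStar_one_of_eq_one, h]
    · simp only [antipodeStar_one_of_eq_two, h]
    · simp only [antipodeStar_one_of_three_le, h]
  · obtain h | h : b = 2 ∨ 3 ≤ b := by omega
    · simp only [antipodeStar_two_of_eq_two, h]
    · simp only [antipodeStar_two_of_three_le, h]
  · obtain h | h : j = b ∨ j ≤ b - 1 := by omega
    · rw [antipodeStar_of_eq _ _ _ hj3 h, antipodeStar_of_eq _ _ _ hj3 h]
    · rw [antipodeStar_of_lt _ _ _ hj3 h, antipodeStar_of_lt _ _ _ hj3 h]

end MalvenutoReutenauer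

end

theorem theorem2p3 {k : Type*} [CommRing k] (n a b : ℕ) (hb : 1 ≤ b) (hba : b < a) (han : a ≤ n) :
    (b = 1 → antipodeStar k (sigma n a b hb hba han) 1 = (-1 : k) ^ (n + 1) • ((word [2] ⧢ delta n 4) ⬝ word [3])) ∧
    (b = 2 → antipodeStar k (sigma n a b hb hba han) 1 = (-1 : k) ^ n • ((word [3, 2] ⧢ delta n 5) ⬝ word [4])) ∧
    (3 ≤ b → antipodeStar k (sigma n a b hb hba han) 1 =
      (-1 : k) ^ (n + b + 1) • ((word [b + 1] ⬝ eta 2 (b - 1) ⧢ delta n (b + 2)) ⬝ word [b]) +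
      ∑ i ∈ Finset.Icc 4 b,
        (-1 : k) ^ (n + i) • (word [i] ⬝ eta 2 (i - 1) ⧢ delta n (i + 1))) ∧
    (b = 1 → a = 2 → antipodeStar k (sigma n a b hb hba han) 2 = (-1 : k) ^ n • (word [1] ⧢ delta n 3)) ∧
    (b = 1 → 3 ≤ a →
      antipodeStar k (sigma n a b hb hba han) 2 = (-1 : k) ^ n • ((word [1] ⧢ delta n 3) + (word [3, 1] ⧢ delta n 4))) ∧
    (b = 2 →
      antipodeStar k (sigma n a b hb hba han) 2 = (-1 : k) ^ (n + 1) • (word [1] ⧢ (word [3] ⧢ delta n 5) ⬝ word [4])) ∧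
    (3 ≤ b →
      antipodeStar k (sigma n a b hb hba han) 2 = (-1 : k) ^ (n + 1) • ((word [1] ⧢ (word [3] ⧢ delta n 5) ⬝ word [4]) +
        (word [4, 3, 1] ⧢ delta n 5))) ∧
    (∀ j, 3 ≤ j → j ≤ b - 1 →
      antipodeStar k (sigma n a b hb hba han) j = (-1 : k) ^ (n + j + 1) •
        (((word [1] ⧢ word [j - 1] ⬝ eta 2 (j - 2)) - delta (j - 1) (j - 2) ⬝ eta 1 (j - 3)) ⧢
            delta n (j + 1) +
          (word [1] ⧢ word [j + 1] ⬝ eta 2 (j - 1) ⧢ delta n (j + 2)) +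
          (delta (j + 2) (j + 1) ⬝ eta 1 (j - 1) ⧢ delta n (j + 3)))) ∧
    (∀ j, 3 ≤ j → j = b →
      antipodeStar k (sigma n a b hb hba han) j = (-1 : k) ^ (n + j + 1) •
        (((word [1] ⧢ word [j - 1] ⬝ eta 2 (j - 2)) - delta (j - 1) (j - 2) ⬝ eta 1 (j - 3)) ⧢
            delta n (j + 1) +
          (word [1] ⧢ word [j + 1] ⬝ eta 2 (j - 1) ⧢ delta n (j + 2)))) ∧
    (∀ j, 3 ≤ j → j = b + 1 → a = b + 1 →
      antipodeStar k (sigma n a b hb hba han) j = (-1 : k) ^ (n + j + 1) •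
        (((word [1] ⧢ word [j - 1] ⬝ eta 2 (j - 2)) - delta (j - 1) (j - 2) ⬝ eta 1 (j - 3)) ⧢
            delta n (j + 1))) ∧
    (∀ j, 3 ≤ j → j = b + 1 → b + 2 ≤ a →
      antipodeStar k (sigma n a b hb hba han) j = (-1 : k) ^ (n + j + 1) •
        (((word [1] ⧢ word [j - 1] ⬝ eta 2 (j - 2)) - delta (j - 1) (j - 2) ⬝ eta 1 (j - 3)) ⧢
            delta n (j + 1) -
          (word [j + 1, j - 1] ⬝ eta 1 (j - 2) ⧢ delta n (j + 2)))) ∧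
    (∀ j, b + 2 ≤ j → j ≤ n → j ≤ a - 1 →
      antipodeStar k (sigma n a b hb hba han) j = (-1 : k) ^ (n + j) •
        ((word [j - 1, b] ⬝ eta 1 (b - 1) ⬝ eta (b + 1) (j - 2) ⧢ delta n (j + 1)) +
          (word [j + 1, b] ⬝ eta 1 (b - 1) ⬝ eta (b + 1) (j - 1) ⧢ delta n (j + 2)))) ∧
    (∀ j, b + 2 ≤ j → j ≤ n → j = a →
      antipodeStar k (sigma n a b hb hba han) j = (-1 : k) ^ (n + j) •
        (word [j - 1, b] ⬝ eta 1 (b - 1) ⬝ eta (b + 1) (j - 2) ⧢ delta n (j + 1))) ∧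
    (∀ j, b + 2 ≤ j → j ≤ n → a + 1 ≤ j → antipodeStar k (sigma n a b hb hba han) j = 0) ∧
    (∀ (j a' : ℕ) (hba' : b < a') (han' : a' ≤ n), 1 ≤ j → j ≤ b →
      antipodeStar k (sigma n a b hb hba han) j = antipodeStar k (sigma n a' b hb hba' han') j) := by

  exact ⟨antipodeStar_one_of_eq_one hb hba han, antipodeStar_one_of_eq_two hb hba han,
    antipodeStar_one_of_three_le hb hba han, antipodeStar_two_of_eq_one_of_eq_two hb hba han,
    antipodeStar_two_of_eq_one_of_three_le hb hba han, antipodeStar_two_of_eq_two hb hba han,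
    antipodeStar_two_of_three_le hb hba han, fun _ => antipodeStar_of_lt hb hba han,
    fun _ => antipodeStar_of_eq hb hba han, fun _ => antipodeStar_of_eq_add_one_of_eq hb hba han,
    fun _ => antipodeStar_of_eq_add_one_of_le hb hba han,
    fun _ => antipodeStar_of_lt_of_lt hb hba han, fun _ => antipodeStar_of_eq_right hb hba han,
    fun _ => antipodeStar_of_gt hb hba han,
    fun _ _ hba' han' => antipodeStar_sigma_congr hb hba han hba' han'⟩
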